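/- Let $q>2$ be an integer and $\beta>\beta_{\mathsf s}:=q$. For $n\ge 1$ let $\pi=\pi_{\beta,n}$ be the mean-field Potts measure on $\{1,\dots,q\}^n$, $$\pi(\sigma)\propto \exp\Big(-\frac{\beta}{n}\sum_{\{u,v\}}\mathbf 1\{\sigma(u)\ne\sigma(v)\}\Big),$$ where the sum is over the edges (unordered pairs) of the complete graph on $[n]$. The Glauber dynamics $(\sigma_t)_{t\ge 0}$ picks at each step a uniformly random vertex $v$ and resamples its spin from $\pi$ conditionally on the other spins, i.e. assigns it spin $k$ with probability proportional to $\exp(\frac{\beta}{n}\#\{u\ne v:\sigma(u)=k\})$. Let $S(\sigma)=(S_1(\sigma),\dots,S_q(\sigma))$ with $S_k(\sigma)=\frac1n\#\{v:\sigma(v)=k\}$ be the proportions vector. Let $m_{\mathsf r}$ be the unique root in $(1/q,1)$ of $$D_\beta(x)=\Big(1+(q-1)\exp\big(\beta\tfrac{1-qx}{q-1}\big)\Big)^{-1}-x .$$ For $i\in\{1,\dots,q\}$ let $s^{(i)}$ be the vector with $i$-th coordinate $m_{\mathsf r}$ and all other coordinates $\frac{1-m_{\mathsf r}}{q-1}$.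 For a sequence $r_n\to0$, let $\Omega_n^{\mathsf{ord},i}=\{\sigma:\|S(\sigma)-s^{(i)}\|_1\le r_n\}$, assumed non-empty for all large $n$, and let $\pi^{\mathsf{ord},i}=\pi(\,\cdot\mid\Omega_n^{\mathsf{ord},i})$. Then there are times $T=T(n)=O(n\log n)$ and a function $\mathrm{err}:\mathbb R\to\mathbb R$ with $\mathrm{err}(\gamma)\to0$ as $\gamma\to\infty$, both depending only on $\beta$ and $q$, such that for every spin $i$, every such sequence $(r_n)$ and every $\gamma>0$, the following holds for all sufficiently large $n$ (depending on $\beta,q,i,(r_n),\gamma$): for every configuration $\sigma_0$ with $S_i(\sigma_0)>S_j(\sigma_0)+\gamma n^{-1/2}$ for all $j\neq i$, $$\big\|\mathbb P_{\sigma_0}(S(\sigma_T)\in\cdot)-\mathbb P_{\pi^{\mathsf{ord},i}}(S(\sigma_T)\in\cdot)\big\|_{\mathrm{TV}}\le \mathrm{err}(\gamma),$$ where $\mathbb P_{\sigma_0}$ and $\mathbb P_{\pi^{\mathsf{ord},i}}$ denote the laws of the Glauber dynamics started from $\sigma_0$ and from $\pi^{\mathsf{ord},i}$, respectively. -/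

import Mathlib

open Filter Topology Asymptotics

namespace Potts

noncomputable section

/-- Spin configurations on the vertex set `Fin n` of the complete graph, with spins in `Fin q`. -/
abbrev Config (n q : ℕ) : Type := Fin n → Fin q

/-- The threshold `β_s = q`. -/
def betaS (q : ℕ) : ℝ := q

/-- The number of edges `{u, v}` of the complete graph on `Fin n` whose endpoints have
different spins (each unordered pair is counted once). -/
def disagreements {n q : ℕ} (σ : Config n q) : ℕ :=
  (Finset.univ.filter fun e : Fin n × Fin n => e.1 < e.2 ∧ σ e.1 ≠ σ e.2).card

/-- The unnormalized mean-field Potts weight. -/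
def weight {n q : ℕ} (β : ℝ) (σ : Config n q) : ℝ :=
  Real.exp (-(β / n) * (disagreements σ : ℝ))

/-- The mean-field Potts measure `π_β`. -/
def gibbs (n q : ℕ) (β : ℝ) (σ : Config n q) : ℝ :=
  weight β σ / ∑ τ : Config n q, weight β τ

/-- The proportions vector `S(σ)`. -/
def proportions {n q : ℕ} (σ : Config n q) (k : Fin q) : ℝ :=
  ((Finset.univ.filter fun v => σ v = k).card : ℝ) / n

/-- The number of vertices other than `v` with spin `k`. -/
def othersWithSpin {n q : ℕ} (σ : Config n q) (v : Fin n) (k : Fin q) : ℕ :=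
  (Finset.univ.filter fun u => u ≠ v ∧ σ u = k).card

/-- The conditional probability that vertex `v` has spin `k`, given the spins of all other
vertices in `σ`. -/
def resampleProb {n q : ℕ} (β : ℝ) (σ : Config n q) (v : Fin n) (k : Fin q) : ℝ :=
  Real.exp (β / n * (othersWithSpin σ v k : ℝ)) /
    ∑ l : Fin q, Real.exp (β / n * (othersWithSpin σ v l : ℝ))

/-- The transition matrix of the Glauber dynamics: choose a vertex uniformly at random and
resample its spin conditionally on the spins of the other vertices. -/
def glauber (n q : ℕ) (β : ℝ) : Matrix (Config n q) (Config n q) ℝ :=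
  fun σ τ => ∑ v : Fin n, ∑ k : Fin q,
    if τ = Function.update σ v k then (1 / (n : ℝ)) * resampleProb β σ v k else 0

/-- The law of `σ_t` when the Glauber dynamics is started from the law `ν`. -/
def lawAt {n q : ℕ} (β : ℝ) (ν : Config n q → ℝ) (t : ℕ) : Config n q → ℝ :=
  Matrix.vecMul ν (glauber n q β ^ t)

/-- The point mass at `σ`. -/
def pointMass {n q : ℕ} (σ : Config n q) : Config n q → ℝ := Pi.single σ 1

open Classical in
/-- The probability that the proportions vector lies in `A`, for a configuration of law `ν`. -/
def proportionsProb {n q : ℕ} (ν : Config n q → ℝ) (A : Set (Fin q → ℝ)) : ℝ :=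
  ∑ σ : Config n q, if proportions σ ∈ A then ν σ else 0

/-- The total-variation distance between the laws of the proportions vectors of configurations
of laws `ν` and `ν'`. -/
def proportionsTV {n q : ℕ} (ν ν' : Config n q → ℝ) : ℝ :=
  ⨆ A : Set (Fin q → ℝ), |proportionsProb ν A - proportionsProb ν' A|

/-- The one-dimensional drift function `D_β`. -/
def drift (q : ℕ) (β x : ℝ) : ℝ :=
  (1 + ((q : ℝ) - 1) * Real.exp (β * ((1 - q * x) / ((q : ℝ) - 1))))⁻¹ - x

/-- `m_r`, the largest root of `D_β` in `(1/q, 1)`; for `q > 2` and `β > q` there is exactly one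
root there. -/
def mr (q : ℕ) (β : ℝ) : ℝ :=
  sSup {x : ℝ | x ∈ Set.Ioo (1 / (q : ℝ)) 1 ∧ drift q β x = 0}

/-- The ordered point with `m_r` in coordinate `i` and `(1 - m_r) / (q - 1)` elsewhere. -/
def orderedPoint (q : ℕ) (β : ℝ) (i : Fin q) (k : Fin q) : ℝ :=
  if k = i then mr q β else (1 - mr q β) / ((q : ℝ) - 1)

/-- The ordered phase of spin `i` with radius `r`: the configurations whose proportions vector is
within `ℓ¹`-distance `r` of the ordered point. -/
def orderedPhase (n q : ℕ) (β : ℝ) (i : Fin q) (r : ℝ) : Set (Config n q) :=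
  {σ | ∑ k : Fin q, |proportions σ k - orderedPoint q β i k| ≤ r}

open Classical in
/-- The Potts measure conditioned on the ordered phase of spin `i` with radius `r`. -/
def gibbsOrdered (n q : ℕ) (β : ℝ) (i : Fin q) (r : ℝ) (σ : Config n q) : ℝ :=
  (if σ ∈ orderedPhase n q β i r then gibbs n q β σ else 0) /
    ∑ τ : Config n q, if τ ∈ orderedPhase n q β i r then gibbs n q β τ else 0

end

end Potts

/-! The proof follows the gaps S_i - S_j between the leading spin i and the others. If all gaps
equal x, a resampled spin has, up to O(1/n), mean gap `gapMap q β x`. Its slope at 0 is β/q > 1, so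
the disordered point repels, and a lead of γ/√n survives the noise with probability tending to 1 as
γ grows. The slope is at least 1 up to some x₀ and below 1 afterwards, while `gapMap` still exceeds
the identity at x₀. Hence `exists_gap_constants` finds b < a such that gaps are pushed upwards all
the way to a, while two copies of the dynamics whose gaps exceed b (with a 1/n margin) contract in
Hamming distance. The contraction factor is governed by the slope at b (`softmax_lipschitz`,
`glauber_mulVec_sub_le`).

Growth of the gaps is measured by `gapPot`, a sum of P-th negative powers. By
`glauber_mulVec_gapPot_le` its mean shrinks by 1 - cP/(8n), up to a small additive error, while all
gaps are at least δ and nδ² ≥ 128P/c. This is used at two scales. A fixed exponent p with δ of order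
n^(-1/2) lifts the gaps from γ/√n to n^(-1/4), with failure probability of order γ^(-p). An exponent
P of order √n with δ of order n^(-1/4) then takes them past a level b' in (b, a) and holds them
there, with failure exponentially small in √n. Finally O(n log n) contracting steps bring the
expected Hamming distance below 1/n.

Neither coupled trajectories nor stopping times are built: all bounds concern powers of the
transition matrix applied to test functions with values in [0, 1], by induction on time
(`abs_pow_mulVec_sub_le_of_biased`). Any two biased starts thus become indistinguishable. The
ordered phase consists of biased configurations because m_r > 1/q (`one_div_lt_mr`), and only this
support property of the conditioned measure is needed. -/

namespace Potts

/-! ### Constants extracted from the one-dimensional drift -/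

/-- The mean difference of the resampling probabilities of the dominant spin and another spin, when
every gap equals `x`. -/
noncomputable def gapMap (q : ℕ) (β x : ℝ) : ℝ :=
  (1 - Real.exp (-β * x)) / (1 + ((q : ℝ) - 1) * Real.exp (-β * x))

/-- The derivative of `gapMap` as a function of `E = exp (-β x)`. -/
noncomputable def gapSlope (q : ℕ) (β E : ℝ) : ℝ := β * (q * E) / (1 + ((q : ℝ) - 1) * E) ^ 2

lemma gapMap_den_pos {q : ℕ} (hq : 2 < q) {E : ℝ} (hE : 0 < E) : 0 < 1 + ((q : ℝ) - 1) * E := by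
  have : (2 : ℝ) < q := by exact_mod_cast hq
  have : 0 < ((q : ℝ) - 1) * E := mul_pos (by linarith) hE
  linarith

lemma hasDerivAt_gapMap {q : ℕ} (hq : 2 < q) (β x : ℝ) :
    HasDerivAt (gapMap q β) (gapSlope q β (Real.exp (-β * x))) x := by
  have hE : HasDerivAt (fun x => Real.exp (-β * x)) (Real.exp (-β * x) * (-β)) x := by
    simpa using ((hasDerivAt_id x).const_mul (-β)).exp
  have hp := gapMap_den_pos hq (Real.exp_pos (-β * x))
  have := (hE.const_sub 1).div ((hE.const_mul ((q : ℝ) - 1)).const_add 1) hp.ne'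
  refine HasDerivAt.congr_deriv (f := gapMap q β) this ?_
  unfold gapSlope
  congr 1
  ring

lemma le_gapSlope_iff {q : ℕ} (hq : 2 < q) {β E s : ℝ} (hE : 0 < E) :
    s ≤ gapSlope q β E ↔ s * (1 + ((q : ℝ) - 1) * E) ^ 2 ≤ β * (q * E) := by
  unfold gapSlope
  rw [le_div_iff₀ (by have := gapMap_den_pos hq hE; positivity)]

/-- If the slope is at least `s` on `[x, y]` then `gapMap` grows at least at rate `s`. -/
lemma gapMap_sub_ge {q : ℕ} (hq : 2 < q) {β s x y : ℝ} (hxy : x ≤ y)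
    (h : ∀ z, x ≤ z → z ≤ y → s ≤ gapSlope q β (Real.exp (-β * z))) :
    s * (y - x) ≤ gapMap q β y - gapMap q β x := by
  refine (convex_Icc x y).mul_sub_le_image_sub_of_le_deriv
    (fun z _ => (hasDerivAt_gapMap hq β z).continuousAt.continuousWithinAt)
    (fun z _ => (hasDerivAt_gapMap hq β z).differentiableAt.differentiableWithinAt)
    (fun z hz => ?_) x (Set.left_mem_Icc.2 hxy) y (Set.right_mem_Icc.2 hxy) hxy
  rw [interior_Icc] at hz
  rw [(hasDerivAt_gapMap hq β z).deriv]
  exact h z hz.1.le hz.2.le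

lemma gapMap_zero (q : ℕ) (β : ℝ) : gapMap q β 0 = 0 := by simp [gapMap]

lemma gapMap_nonneg {q : ℕ} (hq : 2 < q) {β x : ℝ} (hβ : 0 < β) (hx : 0 ≤ x) :
    0 ≤ gapMap q β x := by
  have : Real.exp (-β * x) ≤ 1 := Real.exp_le_one_iff.2 (by nlinarith)
  exact div_nonneg (by linarith) (gapMap_den_pos hq (Real.exp_pos _)).le

/-- The critical value of `exp (-β x)` at which the slope crosses one. -/
lemma exists_critical {q : ℕ} (hq : 2 < q) {β : ℝ} (hβ : (q : ℝ) < β) :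
    ∃ E₀ : ℝ, 0 < E₀ ∧ E₀ < 1 / ((q : ℝ) - 1) ^ 2 ∧
      (∀ E, E₀ ≤ E → E ≤ 1 / ((q : ℝ) - 1) ^ 2 → 1 ≤ gapSlope q β E) ∧
      (∀ E, 0 < E → E < E₀ → gapSlope q β E < 1) := by
  have hq' : (2 : ℝ) < q := by exact_mod_cast hq
  set m : ℝ := (q : ℝ) - 1 with hm
  have hm1 : 1 < m := by linarith
  have hqm : (q : ℝ) = m + 1 := by linarith
  set Q : ℝ → ℝ := fun E => (1 + m * E) ^ 2 - β * (q * E) with hQ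
  have hR : 0 < 1 / m ^ 2 := by positivity
  -- The function E / (1 + mE)² is invariant under E ↦ 1/(m²E), so the slope at 1/m² equals the
  -- slope β/q at E = 1. Here β > q decides the sign.
  have hQR : Q (1 / m ^ 2) < 0 := by
    have : Q (1 / m ^ 2) = (m + 1) * ((q : ℝ) - β) / m ^ 2 := by
      simp only [hQ, hqm]; field_simp
    rw [this]
    exact div_neg_of_neg_of_pos (mul_neg_of_pos_of_neg (by linarith) (by linarith)) (by positivity)
  have hQ0 : 0 < Q 0 := by simp [hQ]
  have hcont : ContinuousOn Q (Set.Icc 0 (1 / m ^ 2)) := by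
    apply Continuous.continuousOn; simp only [hQ]; fun_prop
  obtain ⟨E₀, hE₀, hE₀Q⟩ := intermediate_value_Ioo' hR.le hcont ⟨hQR, hQ0⟩
  have key : ∀ E E', 0 < E → E < E' → E' ≤ 1 / m ^ 2 → Q E' < Q E := by
    intro E E' hE hEE hE'
    have h1 : m ^ 2 * E' ≤ 1 := by
      have := mul_le_mul_of_nonneg_left hE' (by positivity : (0 : ℝ) ≤ m ^ 2)
      rwa [mul_one_div_cancel (by positivity)] at this
    have h2 : m ^ 2 * E ≤ 1 := le_trans (by gcongr) h1
    have h3 : Q E' - Q E = (E' - E) * (m ^ 2 * E + m ^ 2 * E' + 2 * m - β * q) := by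
      simp only [hQ]; ring
    -- The first three terms are at most 2 + 2m = 2q, and β > q > 2.
    have h4 : m ^ 2 * E + m ^ 2 * E' + 2 * m - β * q < 0 := by nlinarith
    have := mul_neg_of_pos_of_neg (sub_pos.2 hEE) h4
    linarith
  refine ⟨E₀, hE₀.1, hE₀.2, fun E h1 h2 => ?_, fun E h1 h2 => ?_⟩
  · rw [le_gapSlope_iff hq (hE₀.1.trans_le h1)]
    have : Q E ≤ 0 := by
      rcases h1.eq_or_lt with h | h
      · rw [← h, hE₀Q]
      · rw [← hE₀Q]; exact (key _ _ hE₀.1 h h2).le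
    simp only [hQ] at this
    linarith
  · rw [← not_le, le_gapSlope_iff hq h1]
    have := key _ _ h1 h2 hE₀.2.le
    rw [hE₀Q] at this
    simp only [hQ] at this
    linarith

/-- Above a positive gap `b` the dynamics contracts, and the gap map expands on an interval
`[0, a]` with `b < a`. -/
lemma exists_gap_constants {q : ℕ} (hq : 2 < q) {β : ℝ} (hβ : (q : ℝ) < β) :
    ∃ b a c : ℝ, 0 < b ∧ b < a ∧ a < 1 ∧ 0 < c ∧ c ≤ 1 ∧
      (∀ x, 0 ≤ x → x ≤ a → (1 + c) * x ≤ gapMap q β x) ∧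
      gapSlope q β (Real.exp (-β * b)) < 1 ∧ ((q : ℝ) + 1) * Real.exp (-β * b) ≤ 1 := by
  have hq' : (3 : ℝ) ≤ q := by exact_mod_cast hq
  have hβ0 : 0 < β := by linarith
  obtain ⟨E₀, hE₀, hE₀R, hge, hlt⟩ := exists_critical hq hβ
  set m : ℝ := (q : ℝ) - 1 with hm
  have hm1 : 2 ≤ m := by linarith
  set R : ℝ := 1 / m ^ 2 with hR
  have hR0 : 0 < R := by positivity
  have hmR : m ^ 2 * R = 1 := mul_one_div_cancel (by positivity)
  have hR1 : R < 1 := by nlinarith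
  set x₁ : ℝ := -Real.log R / β with hx₁
  set x₀ : ℝ := -Real.log E₀ / β with hx₀
  have hx₁0 : 0 < x₁ := div_pos (neg_pos.2 (Real.log_neg hR0 hR1)) hβ0
  have hx₀₁ : x₁ < x₀ := by
    apply div_lt_div_of_pos_right _ hβ0
    linarith [Real.log_lt_log hE₀ hE₀R]
  have hexp₁ : Real.exp (-β * x₁) = R := by
    rw [hx₁, show -β * (-Real.log R / β) = Real.log R by field_simp, Real.exp_log hR0]
  have hexp₀ : Real.exp (-β * x₀) = E₀ := by
    rw [hx₀, show -β * (-Real.log E₀ / β) = Real.log E₀ by field_simp, Real.exp_log hE₀]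
  have hanti : ∀ {x y : ℝ}, x ≤ y → Real.exp (-β * y) ≤ Real.exp (-β * x) := fun h =>
    Real.exp_le_exp.2 (by nlinarith)
  have hantis : ∀ {x y : ℝ}, x < y → Real.exp (-β * y) < Real.exp (-β * x) := fun h =>
    Real.exp_lt_exp.2 (by nlinarith)
  -- slope at least `β / q` up to `x₁`
  have hslope : ∀ x, 0 ≤ x → x ≤ x₁ → β / q * x ≤ gapMap q β x := by
    intro x h0 h1
    have := gapMap_sub_ge hq (β := β) (s := β / q) h0 (fun z hz0 hz1 => ?_)
    · simpa [gapMap_zero] using this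
    · have hE := Real.exp_pos (-β * z)
      rw [le_gapSlope_iff hq hE]
      have hE1 : Real.exp (-β * z) ≤ 1 := Real.exp_le_one_iff.2 (by nlinarith)
      have hE2 : R ≤ Real.exp (-β * z) := hexp₁ ▸ hanti (hz1.trans h1)
      set E := Real.exp (-β * z)
      have h2 : 1 ≤ m ^ 2 * E := by rw [← hmR]; gcongr
      -- The difference of the two sides factors as (1 - E)(m²E - 1).
      have h3 : (1 + m * E) ^ 2 ≤ (q : ℝ) ^ 2 * E := by
        have : (q : ℝ) = m + 1 := by linarith
        rw [this]
        nlinarith [mul_nonneg (sub_nonneg.2 hE1) (sub_nonneg.2 h2)]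
      calc β / q * (1 + m * E) ^ 2 ≤ β / q * ((q : ℝ) ^ 2 * E) := by gcongr
        _ = β * (q * E) := by field_simp
  have hincr : ∀ x, x₁ ≤ x → x ≤ x₀ → gapMap q β x₁ - x₁ ≤ gapMap q β x - x := by
    intro x h1 h2
    have := gapMap_sub_ge hq (β := β) (s := 1) h1 (fun z hz0 hz1 => ?_)
    · linarith
    · exact hge _ (hexp₀ ▸ hanti (hz1.trans h2)) (hexp₁ ▸ hanti hz0)
  set μ : ℝ := (β / q - 1) * x₁ with hμ
  have hβq : 0 < β / q - 1 := sub_pos.2 ((one_lt_div (by linarith)).2 hβ)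
  have hμ0 : 0 < μ := mul_pos hβq hx₁0
  have hμ1 : μ ≤ gapMap q β x₁ - x₁ := by
    have := hslope x₁ hx₁0.le le_rfl
    rw [hμ]; linarith
  have hcont : ContinuousAt (fun x => gapMap q β x - x) x₀ :=
    (hasDerivAt_gapMap hq β x₀).continuousAt.sub continuousAt_id
  have hev : ∀ᶠ x in 𝓝 x₀, μ / 2 < gapMap q β x - x :=
    hcont.eventually_const_lt (by linarith [hincr x₀ hx₀₁.le le_rfl])
  obtain ⟨ε, hε, hball⟩ := Metric.eventually_nhds_iff.1 hev
  -- Past x₀ the slope is below 1, yet by continuity `gapMap` stays above the identity on the ball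
  -- of radius ε. Both b = x₀ + ε/4 and a lie in this overlap.
  set a : ℝ := x₀ + ε / 2 with ha
  have ha0 : 0 < a := by linarith
  have hfa : ∀ x, x₁ ≤ x → x ≤ a → μ / 2 ≤ gapMap q β x - x := by
    intro x h1 h2
    rcases le_total x x₀ with h | h
    · linarith [hincr x h1 h]
    · refine (hball ?_).le
      rw [Real.dist_eq, abs_of_nonneg (by linarith)]
      linarith
  have ha1 : a < 1 := by
    have h1 := hfa a (by linarith) le_rfl
    have h2 : gapMap q β a < 1 := by
      unfold gapMap
      rw [div_lt_one (gapMap_den_pos hq (Real.exp_pos _))]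
      have := Real.exp_pos (-β * a)
      nlinarith
    linarith
  refine ⟨x₀ + ε / 4, a, min (min (β / q - 1) (μ / 2)) 1, by linarith, by linarith, ha1,
    by positivity, min_le_right _ _, ?_, ?_, ?_⟩
  · intro x h0 h1
    set c := min (min (β / q - 1) (μ / 2)) 1
    have hc1 : c ≤ β / q - 1 := (min_le_left _ _).trans (min_le_left _ _)
    have hc2 : c ≤ μ / 2 := (min_le_left _ _).trans (min_le_right _ _)
    rcases le_total x x₁ with h | h
    · have := hslope x h0 h
      nlinarith [mul_le_mul_of_nonneg_right hc1 h0]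
    · have := hfa x h h1
      have : c * x ≤ c * 1 := by gcongr; linarith
      linarith
  · exact hlt _ (Real.exp_pos _) (hexp₀ ▸ hantis (by linarith))
  · have h1 : Real.exp (-β * (x₀ + ε / 4)) ≤ R := hexp₁ ▸ hanti (by linarith)
    have : (q : ℝ) + 1 = m + 2 := by linarith
    rw [this]
    -- The inequality m + 2 ≤ m² means m ≥ 2, that is q ≥ 3: it fails for the Ising case.
    have : (m + 2) * R ≤ m ^ 2 * R := by gcongr; nlinarith
    calc (m + 2) * Real.exp (-β * (x₀ + ε / 4)) ≤ (m + 2) * R := by gcongr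
      _ ≤ 1 := by linarith

/-- The ordered root lies strictly above the disordered one. -/
lemma one_div_lt_mr {q : ℕ} (hq : 2 < q) {β : ℝ} (hβ : (q : ℝ) < β) : 1 / (q : ℝ) < mr q β := by
  have hq' : (2 : ℝ) < q := by exact_mod_cast hq
  obtain ⟨b, a, c, hb, hba, ha1, hc, -, hexpand, -, -⟩ := exists_gap_constants hq hβ
  have ha0 : 0 < a := hb.trans hba
  set m : ℝ := (q : ℝ) - 1 with hm
  have hm1 : 1 < m := by linarith
  have hqm : (q : ℝ) = m + 1 := by linarith
  -- This is the proportion of the leading spin when every gap equals a; the drift is positive there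
  -- exactly because `gapMap` exceeds the identity at a.
  set x : ℝ := (1 + m * a) / q with hx
  have hx1 : x < 1 := by rw [hx, div_lt_one (by linarith)]; nlinarith
  have hxq : 1 / (q : ℝ) < x := by
    rw [hx]; gcongr; nlinarith
  have hDx : 0 < drift q β x := by
    have h := hexpand a ha0.le le_rfl
    have hp := gapMap_den_pos hq (Real.exp_pos (-β * a))
    unfold drift
    rw [← hm] at hp ⊢
    have harg : β * ((1 - q * x) / m) = -β * a := by
      rw [hx]; field_simp; ring
    rw [harg]
    unfold gapMap at h
    rw [← hm] at h
    have h2 : a < (1 - Real.exp (-β * a)) / (1 + m * Real.exp (-β * a)) := by nlinarith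
    rw [lt_div_iff₀ hp] at h2
    rw [sub_pos, hx, inv_eq_one_div, div_lt_div_iff₀ (by linarith) hp, hqm]
    nlinarith
  have hD1 : drift q β 1 < 0 := by
    unfold drift
    rw [← hm]
    have : 0 < m * Real.exp (β * ((1 - q * 1) / m)) := mul_pos (by linarith) (Real.exp_pos _)
    have : (1 + m * Real.exp (β * ((1 - q * 1) / m)))⁻¹ < 1 := inv_lt_one_of_one_lt₀ (by linarith)
    linarith
  have hcont : ContinuousOn (drift q β) (Set.Icc x 1) := by
    unfold drift
    apply Continuous.continuousOn
    refine (Continuous.inv₀ (by fun_prop) fun y => ?_).sub continuous_id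
    exact (gapMap_den_pos hq (Real.exp_pos _)).ne'
  obtain ⟨y, hy, hy0⟩ := intermediate_value_Ioo' hx1.le hcont ⟨hD1, hDx⟩
  -- Since `mr` is a supremum, any one root above 1/q suffices; uniqueness plays no role.
  have : y ≤ mr q β := le_csSup ⟨1, fun z hz => hz.1.2.le⟩ ⟨⟨hxq.trans hy.1, hy.2⟩, hy0⟩
  linarith [hy.1]

section Dynamics

/-! ### The Glauber dynamics as an operator on functions -/

variable {n q : ℕ}

lemma resampleProb_nonneg (β : ℝ) (σ : Config n q) (v : Fin n) (k : Fin q) :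
    0 ≤ resampleProb β σ v k :=
  div_nonneg (Real.exp_pos _).le (Finset.sum_nonneg fun _ _ => (Real.exp_pos _).le)

lemma sum_resampleProb (hq : 0 < q) (β : ℝ) (σ : Config n q) (v : Fin n) :
    ∑ k, resampleProb β σ v k = 1 := by
  unfold resampleProb
  rw [← Finset.sum_div]
  have : Nonempty (Fin q) := ⟨⟨0, hq⟩⟩
  exact div_self (Finset.sum_pos (fun _ _ => Real.exp_pos _) Finset.univ_nonempty).ne'

lemma glauber_mulVec (β : ℝ) (f : Config n q → ℝ) (σ : Config n q) :
    (glauber n q β).mulVec f σ =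
      ∑ v, ∑ k, (1 / (n : ℝ)) * resampleProb β σ v k * f (Function.update σ v k) := by
  simp only [Matrix.mulVec, dotProduct, glauber, Finset.sum_mul]
  rw [Finset.sum_comm]
  refine Finset.sum_congr rfl fun v _ => ?_
  rw [Finset.sum_comm]
  refine Finset.sum_congr rfl fun k _ => ?_
  simp [ite_mul]

lemma glauber_mem_rowStochastic (hn : 0 < n) (hq : 0 < q) (β : ℝ) :
    glauber n q β ∈ Matrix.rowStochastic ℝ (Config n q) := by
  rw [Matrix.mem_rowStochastic]
  constructor
  · intro σ τ
    refine Finset.sum_nonneg fun v _ => Finset.sum_nonneg fun k _ => ?_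
    split_ifs
    · exact mul_nonneg (by positivity) (resampleProb_nonneg _ _ _ _)
    · exact le_rfl
  · funext σ
    rw [glauber_mulVec]
    have : (n : ℝ) ≠ 0 := by exact_mod_cast hn.ne'
    simp [← Finset.mul_sum, sum_resampleProb hq, this]

/-! ### Row-stochastic matrices as averaging operators. -/

section Stochastic

variable {α : Type*} [Fintype α] [DecidableEq α] {A : Matrix α α ℝ}

lemma mulVec_mono_of_stochastic (hA : A ∈ Matrix.rowStochastic ℝ α) {f g : α → ℝ}
    (h : ∀ x, f x ≤ g x) (x : α) : A.mulVec f x ≤ A.mulVec g x :=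
  Finset.sum_le_sum fun y _ =>
    mul_le_mul_of_nonneg_left (h y) (Matrix.nonneg_of_mem_rowStochastic hA)

lemma mulVec_affine_of_stochastic (hA : A ∈ Matrix.rowStochastic ℝ α) (s u : ℝ) (f : α → ℝ)
    (x : α) : A.mulVec (fun y => s * f y + u) x = s * A.mulVec f x + u := by
  simp only [Matrix.mulVec, dotProduct, mul_add, Finset.sum_add_distrib]
  rw [← Finset.sum_mul, Matrix.sum_row_of_mem_rowStochastic hA, Finset.mul_sum]
  simp only [one_mul]
  congr 1
  exact Finset.sum_congr rfl fun _ _ => by ring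

lemma mulVec_mem_unit_of_stochastic (hA : A ∈ Matrix.rowStochastic ℝ α) {f : α → ℝ}
    (h0 : ∀ x, 0 ≤ f x) (h1 : ∀ x, f x ≤ 1) (x : α) :
    0 ≤ A.mulVec f x ∧ A.mulVec f x ≤ 1 := by
  constructor
  · have := mulVec_mono_of_stochastic hA (f := fun y => 0 * f y + 0) (g := f) (by simpa using h0) x
    rw [mulVec_affine_of_stochastic hA] at this
    simpa using this
  · have := mulVec_mono_of_stochastic hA (f := f) (g := fun y => 0 * f y + 1) (by simpa using h1) x
    rw [mulVec_affine_of_stochastic hA] at this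
    simpa using this

lemma pow_succ_mulVec (A : Matrix α α ℝ) (t : ℕ) (f : α → ℝ) :
    (A ^ (t + 1)).mulVec f = A.mulVec ((A ^ t).mulVec f) := by
  rw [pow_succ', Matrix.mulVec_mulVec]

/-- Averaging over two independent copies preserves a separated bound on differences. -/
lemma abs_mulVec_sub_le_of_stochastic (hA : A ∈ Matrix.rowStochastic ℝ α) {f B : α → ℝ} {w : ℝ}
    (h : ∀ x y, |f x - f y| ≤ w + B x + B y) (x y : α) :
    |A.mulVec f x - A.mulVec f y| ≤ w + A.mulVec B x + A.mulVec B y := by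
  have key : ∀ x y, A.mulVec f x ≤ A.mulVec f y + (w + A.mulVec B x + A.mulVec B y) := by
    intro x y
    -- Average over the first copy with the second frozen at z, then over z; the separated form of
    -- the bound makes any coupling unnecessary.
    have h1 : ∀ z, A.mulVec f x ≤ f z + (w + A.mulVec B x + B z) := by
      intro z
      have := mulVec_mono_of_stochastic hA (f := f) (g := fun y => 1 * B y + (f z + w + B z))
        (fun u => by have := (abs_le.1 (h u z)).2; linarith) x
      rw [mulVec_affine_of_stochastic hA] at this
      linarith
    have h2 : A.mulVec (fun z => 1 * f z + (w + A.mulVec B x)) y = _ :=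
      mulVec_affine_of_stochastic hA _ _ _ _
    have h3 := mulVec_mono_of_stochastic hA (f := fun z => (-1) * B z + A.mulVec f x)
      (g := fun z => 1 * f z + (w + A.mulVec B x)) (fun z => by linarith [h1 z]) y
    rw [h2, mulVec_affine_of_stochastic hA] at h3
    linarith
  rw [abs_le]
  constructor
  · linarith [key y x]
  · linarith [key x y]

/-- A Lyapunov bound for a stochastic matrix: `Ψ` contracts on `G` up to an error `e`, and is large
off `G`. -/
lemma pow_mulVec_le_of_drift (hA : A ∈ Matrix.rowStochastic ℝ α) {Ψ g : α → ℝ} {G : Set α}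
    {l e s u θ : ℝ} (hl0 : 0 ≤ l) (hl1 : l ≤ 1) (he : 0 ≤ e) (hs : 0 ≤ s) (hu : 0 ≤ u)
    (hθ : 0 ≤ θ) (hΨ : ∀ x, 0 ≤ Ψ x) (hdrift : ∀ x ∈ G, A.mulVec Ψ x ≤ l * Ψ x + e)
    (hoff : ∀ x ∉ G, 1 ≤ θ * Ψ x) (hg0 : ∀ x, 0 ≤ g x) (hg1 : ∀ x, g x ≤ 1)
    (hg : ∀ x, g x ≤ s * Ψ x + u) (t : ℕ) (x : α) :
    (A ^ t).mulVec g x ≤ s * l ^ t * Ψ x + θ * Ψ x + t * ((s + θ) * e) + u := by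
  induction t generalizing x with
  | zero => simpa using (hg x).trans (by have := mul_nonneg hθ (hΨ x); linarith)
  | succ t ih =>
    by_cases hx : x ∈ G
    · rw [pow_succ_mulVec]
      have h1 := mulVec_mono_of_stochastic hA (f := (A ^ t).mulVec g) (g := fun x => (s * l ^ t + θ) * Ψ x +
        (t * ((s + θ) * e) + u)) (fun x => by linarith [ih x]) x
      rw [mulVec_affine_of_stochastic hA] at h1
      have h2 : (s * l ^ t + θ) * A.mulVec Ψ x ≤ (s * l ^ t + θ) * (l * Ψ x + e) :=
        mul_le_mul_of_nonneg_left (hdrift x hx) (by positivity)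
      have h3 : θ * (l * Ψ x) ≤ θ * (1 * Ψ x) := by have := hΨ x; gcongr
      have h4 : s * l ^ t * e ≤ s * 1 * e := by gcongr; exact pow_le_one₀ hl0 hl1
      push_cast
      rw [pow_succ]
      linarith
    -- Outside G the trivial bound 1 is already below θΨ, which replaces a stopping-time argument.
    · have h1 := (mulVec_mem_unit_of_stochastic (pow_mem hA (t + 1)) hg0 hg1 x).2
      have h2 := hoff x hx
      have := hΨ x
      have : 0 ≤ s * l ^ (t + 1) * Ψ x := by positivity
      have : 0 ≤ ((t + 1 : ℕ) : ℝ) * ((s + θ) * e) := by positivity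
      linarith

end Stochastic

/-- Only single-site updates of σ are compared, so g may be a local bound for f, such as a tangent
line plus an error, that fails far from σ. -/
lemma glauber_mulVec_mono (β : ℝ) {f g : Config n q → ℝ} {σ : Config n q}
    (h : ∀ v k, f (Function.update σ v k) ≤ g (Function.update σ v k)) :
    (glauber n q β).mulVec f σ ≤ (glauber n q β).mulVec g σ := by
  rw [glauber_mulVec, glauber_mulVec]
  exact Finset.sum_le_sum fun v _ => Finset.sum_le_sum fun k _ =>
    mul_le_mul_of_nonneg_left (h v k) (mul_nonneg (by positivity) (resampleProb_nonneg _ _ _ _))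

/-! ### Proportions and gaps -/

/-- The gap between the proportions of the spins `i` and `j`. -/
noncomputable def gap (i j : Fin q) (σ : Config n q) : ℝ := proportions σ i - proportions σ j

lemma proportions_eq_sum (σ : Config n q) (k : Fin q) :
    proportions σ k = (∑ u, if σ u = k then (1 : ℝ) else 0) / n := by
  simp [proportions]

lemma proportions_update (σ : Config n q) (v : Fin n) (k l : Fin q) :
    proportions (Function.update σ v k) l =
      proportions σ l + ((if k = l then 1 else 0) - (if σ v = l then 1 else 0)) / n := by
  rw [proportions_eq_sum, proportions_eq_sum, ← add_div]
  congr 1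
  rw [← Finset.add_sum_erase _ _ (Finset.mem_univ v), ← Finset.add_sum_erase (a := v)
    (f := fun u => if σ u = l then (1 : ℝ) else 0) _ (Finset.mem_univ v)]
  rw [Finset.sum_congr rfl (g := fun u => if σ u = l then (1 : ℝ) else 0)]
  · rw [Function.update_self]
    ring
  · intro u hu
    rw [Function.update_of_ne (Finset.ne_of_mem_erase hu)]

lemma abs_gap_update_sub_le (σ : Config n q) (v : Fin n) (k i j : Fin q) :
    |gap i j (Function.update σ v k) - gap i j σ| ≤ 2 / n := by
  unfold gap
  rw [proportions_update, proportions_update]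
  set A : ℝ := (if k = i then 1 else 0) with hA
  set B : ℝ := (if σ v = i then 1 else 0) with hB
  set C : ℝ := (if k = j then 1 else 0) with hC
  set D : ℝ := (if σ v = j then 1 else 0) with hD
  have h : ∀ {p : Prop} [Decidable p], (0 : ℝ) ≤ (if p then 1 else 0) ∧
      (if p then (1 : ℝ) else 0) ≤ 1 := by intro p _; split_ifs <;> norm_num
  have hA' : 0 ≤ A ∧ A ≤ 1 := h
  have hB' : 0 ≤ B ∧ B ≤ 1 := h
  have hC' : 0 ≤ C ∧ C ≤ 1 := h
  have hD' : 0 ≤ D ∧ D ≤ 1 := h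
  rw [show proportions σ i + (A - B) / n - (proportions σ j + (C - D) / n) -
    (proportions σ i - proportions σ j) = ((A - B) - (C - D)) / n by ring, abs_div,
    abs_of_nonneg (Nat.cast_nonneg (α := ℝ) n)]
  gcongr
  rw [abs_le]
  constructor <;> linarith

lemma othersWithSpin_div (σ : Config n q) (v : Fin n) (k : Fin q) :
    (othersWithSpin σ v k : ℝ) / n = proportions σ k - (if σ v = k then 1 else 0) / n := by
  rw [proportions_eq_sum, ← sub_div]
  congr 1
  rw [← Finset.add_sum_erase _ _ (Finset.mem_univ v), add_sub_cancel_left]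
  unfold othersWithSpin
  rw [Finset.sum_ite, Finset.sum_const_zero, add_zero, Finset.sum_const, nsmul_eq_mul, mul_one]
  congr 2
  ext u
  simp

/-- The softmax (Gibbs weights) of a vector. -/
noncomputable def softmax (β : ℝ) (x : Fin q → ℝ) (k : Fin q) : ℝ :=
  Real.exp (β * x k) / ∑ l, Real.exp (β * x l)

lemma resampleProb_eq_softmax (β : ℝ) (σ : Config n q) (v : Fin n) (k : Fin q) :
    resampleProb β σ v k = softmax β (fun l => (othersWithSpin σ v l : ℝ) / n) k := by
  unfold resampleProb softmax
  simp only [div_mul_eq_mul_div, mul_div_assoc]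

/-- The resampling law ignores the spin at v itself, which costs at most 1/n; this is the source of
every 1/n correction below. -/
lemma others_gap_ge (σ : Config n q) (v : Fin n) (i j : Fin q) :
    gap i j σ - 1 / n ≤ (othersWithSpin σ v i : ℝ) / n - (othersWithSpin σ v j : ℝ) / n := by
  rw [othersWithSpin_div, othersWithSpin_div]
  unfold gap
  have h1 : (if σ v = i then (1 : ℝ) else 0) / n ≤ 1 / n := by gcongr; split_ifs <;> norm_num
  have h2 : 0 ≤ (if σ v = j then (1 : ℝ) else 0) / n := by split_ifs <;> positivity
  linarith

/-- If every gap is at least `x ≥ 0` then the softmax of `i` exceeds the others by at least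
`gapMap q β x`. -/
lemma gapMap_le_softmax_sub {β : ℝ} (hβ : 0 < β) (hq : 2 < q) {x : ℝ} (hx : 0 ≤ x) {y : Fin q → ℝ}
    {i : Fin q} (h : ∀ l, l ≠ i → x ≤ y i - y l) {j : Fin q} (hj : j ≠ i) :
    gapMap q β x ≤ softmax β y i - softmax β y j := by
  unfold softmax gapMap
  rw [← sub_div]
  have hle : ∀ l, l ≠ i → Real.exp (β * y l) ≤ Real.exp (β * y i) * Real.exp (-β * x) := by
    intro l hl
    rw [← Real.exp_add]
    exact Real.exp_le_exp.2 (by nlinarith [h l hl])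
  have hsum : ∑ l, Real.exp (β * y l) ≤
      Real.exp (β * y i) * (1 + ((q : ℝ) - 1) * Real.exp (-β * x)) := by
    rw [← Finset.add_sum_erase _ _ (Finset.mem_univ i)]
    have := Finset.sum_le_card_nsmul (Finset.univ.erase i) (fun l => Real.exp (β * y l)) _
      (fun l hl => hle l (Finset.ne_of_mem_erase hl))
    rw [Finset.card_erase_of_mem (Finset.mem_univ i), Finset.card_univ, Fintype.card_fin,
      nsmul_eq_mul, Nat.cast_sub (by omega)] at this
    push_cast at this
    linarith
  have hpos : 0 < ∑ l, Real.exp (β * y l) :=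
    Finset.sum_pos (fun _ _ => Real.exp_pos _) ⟨i, Finset.mem_univ i⟩
  have hE1 : Real.exp (-β * x) ≤ 1 := Real.exp_le_one_iff.2 (by nlinarith)
  have hi := Real.exp_pos (β * y i)
  rw [div_le_div_iff₀ (gapMap_den_pos hq (Real.exp_pos _)) hpos]
  have hden := gapMap_den_pos hq (Real.exp_pos (-β * x))
  calc (1 - Real.exp (-β * x)) * ∑ l, Real.exp (β * y l)
      ≤ (1 - Real.exp (-β * x)) *
        (Real.exp (β * y i) * (1 + ((q : ℝ) - 1) * Real.exp (-β * x))) := by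
        gcongr
    _ = (Real.exp (β * y i) - Real.exp (β * y i) * Real.exp (-β * x)) *
        (1 + ((q : ℝ) - 1) * Real.exp (-β * x)) := by ring
    _ ≤ _ := by gcongr; exact hle j hj

/-- Expected one-step change of the proportion of spin `l`. -/
lemma glauber_mulVec_proportions (hn : 0 < n) (hq : 0 < q) (β : ℝ) (σ : Config n q) (l : Fin q) :
    (glauber n q β).mulVec (fun τ => proportions τ l) σ =
      proportions σ l + ((∑ v, resampleProb β σ v l) / n - proportions σ l) / n := by
  have hn' : (n : ℝ) ≠ 0 := by exact_mod_cast hn.ne'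
  rw [glauber_mulVec]
  have : ∀ v : Fin n, ∑ k, (1 / (n : ℝ)) * resampleProb β σ v k *
      proportions (Function.update σ v k) l =
      proportions σ l / n + (resampleProb β σ v l - (if σ v = l then 1 else 0)) / n / n := by
    intro v
    simp only [proportions_update]
    have : ∀ k, (1 / (n : ℝ)) * resampleProb β σ v k *
        (proportions σ l + ((if k = l then 1 else 0) - (if σ v = l then 1 else 0)) / n) =
        resampleProb β σ v k * ((proportions σ l - (if σ v = l then 1 else 0) / n) / n) +
        (if k = l then resampleProb β σ v k else 0) / n / n := by
      intro k; split_ifs <;> field_simp <;> ring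
    simp only [this, Finset.sum_add_distrib, ← Finset.sum_mul, sum_resampleProb hq,
      ← Finset.sum_div, Finset.sum_ite_eq', Finset.mem_univ, if_true]
    ring
  simp only [this, Finset.sum_add_distrib, ← Finset.sum_div, Finset.sum_sub_distrib]
  conv_rhs => rw [proportions_eq_sum]
  conv_lhs => rw [proportions_eq_sum]
  simp
  field_simp

/-- Lower bound for the drift of a gap in terms of a common lower bound for all the gaps. -/
lemma glauber_mulVec_gap_ge {β : ℝ} (hβ : 0 < β) (hq : 2 < q) (hn : 0 < n) {σ : Config n q}
    {i j : Fin q} (hj : j ≠ i) {d : ℝ} (hd : 1 / n ≤ d) (h : ∀ l, l ≠ i → d ≤ gap i l σ) :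
    gap i j σ + (gapMap q β (d - 1 / n) - gap i j σ) / n ≤
      (glauber n q β).mulVec (gap i j) σ := by
  have h1 : (glauber n q β).mulVec (gap i j) σ =
      (glauber n q β).mulVec (fun τ => proportions τ i) σ -
      (glauber n q β).mulVec (fun τ => proportions τ j) σ := by
    rw [← Pi.sub_apply, ← Matrix.mulVec_sub]; rfl
  rw [h1, glauber_mulVec_proportions hn (by omega), glauber_mulVec_proportions hn (by omega)]
  have hn' : (0 : ℝ) < n := by exact_mod_cast hn
  have h2 : gapMap q β (d - 1 / n) ≤
      (∑ v, resampleProb β σ v i) / n - (∑ v, resampleProb β σ v j) / n := by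
    rw [← sub_div, ← Finset.sum_sub_distrib, le_div_iff₀ hn']
    have := Finset.card_nsmul_le_sum Finset.univ
      (fun v => resampleProb β σ v i - resampleProb β σ v j) (gapMap q β (d - 1 / n)) (fun v _ => ?_)
    · simpa [mul_comm] using this
    · rw [resampleProb_eq_softmax, resampleProb_eq_softmax]
      exact gapMap_le_softmax_sub hβ hq (by linarith)
        (fun l hl => (sub_le_sub_right (h l hl) _).trans (others_gap_ge σ v i l)) hj
  have h3 : gapMap q β (d - 1 / n) / n ≤
      ((∑ v, resampleProb β σ v i) / n - (∑ v, resampleProb β σ v j) / n) / n := by gcongr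
  unfold gap
  simp only [sub_div] at h3 ⊢
  linarith

/-! ### Contraction of the dynamics where one spin dominates -/

/-- A maximal coupling of two probability vectors. -/
lemma exists_maximal_coupling {r r' : Fin q → ℝ} (hr : ∀ k, 0 ≤ r k) (hr' : ∀ k, 0 ≤ r' k)
    (hsum : ∑ k, r k = ∑ k, r' k) :
    ∃ (p : Fin q → Fin q → ℝ) (φ : Fin q → ℝ), (∀ k k', 0 ≤ p k k') ∧
      (∀ k, ∑ k', p k k' = r k) ∧ (∀ k', ∑ k, p k k' = r' k') ∧
      (∀ k, φ k = 0 ∨ φ k = 1) ∧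
      ∑ k, ∑ k', p k k' * (if k ≠ k' then 1 else 0) ≤ ∑ k, φ k * (r k - r' k) := by
  set m : Fin q → ℝ := fun k => min (r k) (r' k) with hm
  set D : ℝ := ∑ k, (r k - m k) with hD
  have hD' : ∑ k, (r' k - m k) = D := by
    rw [hD, Finset.sum_sub_distrib, Finset.sum_sub_distrib, hsum]
  have h1 : ∀ k, 0 ≤ r k - m k := fun k => sub_nonneg.2 (min_le_left _ _)
  have h2 : ∀ k, 0 ≤ r' k - m k := fun k => sub_nonneg.2 (min_le_right _ _)
  have hD0 : 0 ≤ D := Finset.sum_nonneg fun k _ => h1 k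
  have hcancel : ∀ {x : ℝ}, 0 ≤ x → x ≤ D → x * D / D = x := by
    intro x hx hxD
    rcases hD0.eq_or_lt with h | h
    · have : x = 0 := le_antisymm (by linarith) hx
      simp [this]
    · field_simp
  have h1D : ∀ k, r k - m k ≤ D := fun k =>
    Finset.single_le_sum (f := fun k => r k - m k) (fun k _ => h1 k) (Finset.mem_univ k)
  have h2D : ∀ k, r' k - m k ≤ D := fun k => by
    rw [← hD']
    exact Finset.single_le_sum (f := fun k => r' k - m k) (fun k _ => h2 k) (Finset.mem_univ k)
  -- The common mass stays on the diagonal and the residuals are coupled independently. If D = 0 the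
  -- residuals vanish and the convention x / 0 = 0 is harmless. The indicator φ of {r' < r} attains
  -- the total variation distance.
  refine ⟨fun k k' => (if k = k' then m k else 0) + (r k - m k) * (r' k' - m k') / D,
    fun k => if r' k < r k then 1 else 0, fun k k' => ?_, fun k => ?_, fun k' => ?_,
    fun k => ?_, ?_⟩
  · have : 0 ≤ (if k = k' then m k else 0) := by
      split_ifs
      · exact le_min (hr k) (hr' k)
      · exact le_rfl
    have := mul_nonneg (h1 k) (h2 k')
    positivity
  · rw [Finset.sum_add_distrib, ← Finset.sum_div, ← Finset.mul_sum, hD', hcancel (h1 k) (h1D k)]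
    simp
  · rw [Finset.sum_add_distrib, ← Finset.sum_div, ← Finset.sum_mul, ← hD, mul_comm D,
      hcancel (h2 k') (h2D k')]
    simp
  · by_cases h : r' k < r k <;> simp [h]
  · calc ∑ k, ∑ k', ((if k = k' then m k else 0) + (r k - m k) * (r' k' - m k') / D) *
          (if k ≠ k' then 1 else 0)
        ≤ ∑ k, ∑ k', (r k - m k) * (r' k' - m k') / D := by
          refine Finset.sum_le_sum fun k _ => Finset.sum_le_sum fun k' _ => ?_
          by_cases h : k = k'
          · have := mul_nonneg (h1 k) (h2 k')
            simp only [h, ne_eq, not_true_eq_false, if_false, mul_zero]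
            rw [← h]
            exact div_nonneg (mul_nonneg (h1 k) (h ▸ h2 k)) hD0
          · simp [h]
      _ = D := by
          simp only [← Finset.sum_div, ← Finset.mul_sum, hD', ← Finset.sum_mul]
          exact hcancel hD0 le_rfl
      _ ≤ _ := by
          refine Finset.sum_le_sum fun k _ => ?_
          simp only [hm]
          split_ifs with h
          · rw [min_eq_right h.le, one_mul]
          · rw [min_eq_left (not_lt.1 h), zero_mul, sub_self]

/-- As w has zero sum, c may be recentred at the midpoint of its range, where it is at most D/2 in
absolute value. -/
lemma sum_mul_le_of_sum_eq_zero {w c : Fin q → ℝ} {D : ℝ} (hw : ∑ k, w k = 0)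
    (hc : ∀ k l, c k - c l ≤ D) : ∑ k, w k * c k ≤ D * (∑ k, |w k| / 2) := by
  rcases isEmpty_or_nonempty (Fin q) with h | h
  · simp
  obtain ⟨M, hM⟩ := Finite.exists_max c
  obtain ⟨m, hm⟩ := Finite.exists_min c
  have h1 : ∑ k, w k * c k = ∑ k, w k * (c k - (c M + c m) / 2) := by
    simp only [mul_sub, Finset.sum_sub_distrib, ← Finset.sum_mul, hw]
    ring
  rw [h1, Finset.mul_sum]
  refine Finset.sum_le_sum fun k _ => ?_
  have h2 : |c k - (c M + c m) / 2| ≤ D / 2 := by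
    rw [abs_le]
    constructor <;> linarith [hM k, hm k, hc M m]
  calc w k * (c k - (c M + c m) / 2) ≤ |w k * (c k - (c M + c m) / 2)| := le_abs_self _
    _ = |w k| * |c k - (c M + c m) / 2| := abs_mul _ _
    _ ≤ |w k| * (D / 2) := by gcongr
    _ = D * (|w k| / 2) := by ring

/-- Oscillation of the covariance coefficients of a subset of spins under a probability vector with
dominant coordinate `i`. -/
lemma covariance_coeff_sub_le {g φ : Fin q → ℝ} {i : Fin q} {t : ℝ} (hg : ∀ k, 0 ≤ g k)
    (hsum : ∑ k, g k = 1) (hφ : ∀ k, φ k = 0 ∨ φ k = 1) (hgt : ∀ k, k ≠ i → g k ≤ t)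
    (ht0 : 0 ≤ t) (ht : t ≤ g i) (k l : Fin q) :
    g k * (φ k - ∑ j, φ j * g j) - g l * (φ l - ∑ j, φ j * g j) ≤ g i * (1 - g i + t) := by
  set p := ∑ j, φ j * g j with hp
  have hφ0 : ∀ k, 0 ≤ φ k := fun k => by rcases hφ k with h | h <;> simp [h]
  have hφ1 : ∀ k, φ k ≤ 1 := fun k => by rcases hφ k with h | h <;> simp [h]
  have hp0 : 0 ≤ p := Finset.sum_nonneg fun k _ => mul_nonneg (hφ0 k) (hg k)
  have hp1 : p ≤ 1 := by
    rw [← hsum]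
    exact Finset.sum_le_sum fun k _ => mul_le_of_le_one_left (hg k) (hφ1 k)
  have hle : ∀ k, g k ≤ g i := fun k => by
    by_cases h : k = i
    · rw [h]
    · exact (hgt k h).trans ht
  -- If i lies outside the subset, the oscillation is at most t(1 - p) + g_i p, which is
  -- nondecreasing in p because g_i ≥ t, and p ≤ 1 - g_i. If i lies inside, complementation
  -- exchanges p and 1 - p.
  rcases hφ i with hi | hi
  · have hpi : p ≤ 1 - g i := by
      have : ∑ j, (1 - φ j) * g j = 1 - p := by
        simp only [sub_mul, one_mul, Finset.sum_sub_distrib, hsum, hp]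
      have h2 := Finset.single_le_sum (f := fun j => (1 - φ j) * g j)
        (fun j _ => mul_nonneg (sub_nonneg.2 (hφ1 j)) (hg j)) (Finset.mem_univ i)
      rw [this] at h2
      simp only [hi, sub_zero, one_mul] at h2
      linarith
    have hup : ∀ k, g k * (φ k - p) ≤ t * (1 - p) := by
      intro k
      rcases hφ k with h | h
      · rw [h]
        have := mul_nonneg (hg k) hp0
        have := mul_nonneg ht0 (sub_nonneg.2 hp1)
        linarith
      · rw [h]
        refine mul_le_mul_of_nonneg_right (hgt k ?_) (by linarith)
        rintro rfl
        rw [hi] at h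
        norm_num at h
    have hdown : ∀ k, -(g i * p) ≤ g k * (φ k - p) := by
      intro k
      have h1 := mul_nonneg (hg k) (hφ0 k)
      have h2 := mul_le_mul_of_nonneg_right (hle k) hp0
      linarith
    have h3 : 0 ≤ (1 - g i - p) * (g i - t) := mul_nonneg (by linarith) (by linarith)
    linarith [hup k, hdown l]
  · have hpi : g i ≤ p := by
      have h2 := Finset.single_le_sum (f := fun j => φ j * g j)
        (fun j _ => mul_nonneg (hφ0 j) (hg j)) (Finset.mem_univ i)
      simpa [hi] using h2
    have hup : ∀ k, g k * (φ k - p) ≤ g i * (1 - p) := by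
      intro k
      have h1 : g k * (φ k - p) ≤ g k * (1 - p) :=
        mul_le_mul_of_nonneg_left (by linarith [hφ1 k]) (hg k)
      exact h1.trans (mul_le_mul_of_nonneg_right (hle k) (by linarith))
    have hdown : ∀ k, -(t * p) ≤ g k * (φ k - p) := by
      intro k
      rcases hφ k with h | h
      · rw [h]
        have := mul_le_mul_of_nonneg_right (hgt k (by rintro rfl; rw [hi] at h; norm_num at h)) hp0
        linarith
      · rw [h]
        have := mul_nonneg (hg k) (sub_nonneg.2 hp1)
        have := mul_nonneg ht0 hp0
        linarith
    have h3 : 0 ≤ (p - g i) * (g i - t) := mul_nonneg (by linarith) (by linarith)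
    linarith [hup k, hdown l]

lemma softmax_den_pos (β : ℝ) (i : Fin q) (x : Fin q → ℝ) : 0 < ∑ l, Real.exp (β * x l) :=
  Finset.sum_pos (fun _ _ => Real.exp_pos _) ⟨i, Finset.mem_univ i⟩

lemma sum_softmax (β : ℝ) (i : Fin q) (x : Fin q → ℝ) : ∑ k, softmax β x k = 1 := by
  unfold softmax
  rw [← Finset.sum_div]
  exact div_self (softmax_den_pos β i x).ne'

lemma softmax_nonneg (β : ℝ) (x : Fin q → ℝ) (k : Fin q) : 0 ≤ softmax β x k :=
  div_nonneg (Real.exp_pos _).le (Finset.sum_nonneg fun _ _ => (Real.exp_pos _).le)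

/-- The derivative of W ↦ (W + E)/(1 + W)² has the sign of 1 - W - 2E, nonnegative up to W₀. -/
lemma dominant_variance_le {W W₀ E : ℝ} (hW : 0 ≤ W) (hWW : W ≤ W₀) (hE : 0 ≤ E)
    (h : W₀ + 2 * E ≤ 1) :
    (W + E) / (1 + W) ^ 2 ≤ (W₀ + E) / (1 + W₀) ^ 2 := by
  rw [div_le_div_iff₀ (by positivity) (by nlinarith)]
  have h1 : 0 ≤ 1 - W * W₀ - E * (2 + W + W₀) := by
    nlinarith [mul_nonneg (hW.trans hWW) (sub_nonneg.2 h), mul_nonneg (hW.trans hWW)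
      (sub_nonneg.2 hWW), mul_nonneg hE (sub_nonneg.2 hWW)]
  nlinarith [mul_nonneg (sub_nonneg.2 hWW) h1]

/-- When all the gaps are at least `b`, the covariance coefficients oscillate by at most
`gapSlope / β`. -/
lemma softmax_oscillation_le {β b : ℝ} (hβ : 0 < β) (hb : 0 ≤ b) (hq : 2 < q)
    (hE : ((q : ℝ) + 1) * Real.exp (-β * b) ≤ 1) {z : Fin q → ℝ} {i : Fin q}
    (hz : ∀ j, j ≠ i → b ≤ z i - z j) {φ : Fin q → ℝ} (hφ : ∀ k, φ k = 0 ∨ φ k = 1)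
    (k l : Fin q) :
    β * (softmax β z k * (φ k - ∑ j, φ j * softmax β z j) -
      softmax β z l * (φ l - ∑ j, φ j * softmax β z j)) ≤ gapSlope q β (Real.exp (-β * b)) := by
  have hq' : (2 : ℝ) < q := by exact_mod_cast hq
  set E := Real.exp (-β * b) with hEdef
  have hE0 : 0 < E := Real.exp_pos _
  have hE1 : E ≤ 1 := Real.exp_le_one_iff.2 (by nlinarith)
  set g := softmax β z with hg
  have hden := softmax_den_pos β i z
  set X := Real.exp (β * z i) with hX
  have hX0 : 0 < X := Real.exp_pos _
  have hle : ∀ j, j ≠ i → Real.exp (β * z j) ≤ X * E := by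
    intro j hj
    rw [hX, hEdef, ← Real.exp_add]
    exact Real.exp_le_exp.2 (by nlinarith [hz j hj])
  have hgt : ∀ j, j ≠ i → g j ≤ g i * E := by
    intro j hj
    simp only [hg, softmax]
    rw [div_mul_eq_mul_div]
    gcongr
    exact hle j hj
  have hgi0 : 0 ≤ g i := softmax_nonneg _ _ _
  have h1 := covariance_coeff_sub_le (g := g) (φ := φ) (i := i) (t := g i * E)
    (fun k => softmax_nonneg _ _ _) (sum_softmax β i z) hφ hgt (by positivity)
    (mul_le_of_le_one_right hgi0 hE1) k l
  -- W is the mass of the other spins relative to i. The bound increases with W, so the worst case W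
  -- = (q - 1)E, all gaps equal to b, yields precisely the slope of `gapMap` at b.
  set W := (∑ j ∈ Finset.univ.erase i, Real.exp (β * z j)) / X with hW
  have hW0 : 0 ≤ W := div_nonneg (Finset.sum_nonneg fun _ _ => (Real.exp_pos _).le) hX0.le
  have hW1 : W ≤ ((q : ℝ) - 1) * E := by
    rw [hW, div_le_iff₀ hX0]
    have := Finset.sum_le_card_nsmul (Finset.univ.erase i) (fun l => Real.exp (β * z l)) _
      (fun l hl => hle l (Finset.ne_of_mem_erase hl))
    rw [Finset.card_erase_of_mem (Finset.mem_univ i), Finset.card_univ, Fintype.card_fin,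
      nsmul_eq_mul, Nat.cast_sub (by omega)] at this
    push_cast at this
    linarith
  have hgi : g i = 1 / (1 + W) := by
    simp only [hg, softmax]
    rw [← Finset.add_sum_erase _ _ (Finset.mem_univ i), ← hX, hW]
    field_simp
  have h2 : g i * (1 - g i + g i * E) = (W + E) / (1 + W) ^ 2 := by
    rw [hgi]; field_simp; ring
  have h3 := dominant_variance_le hW0 hW1 hE0.le (by linarith)
  calc β * _ ≤ β * (g i * (1 - g i + g i * E)) := by gcongr
    _ ≤ β * ((((q : ℝ) - 1) * E + E) / (1 + ((q : ℝ) - 1) * E) ^ 2) := by rw [h2]; gcongr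
    _ = gapSlope q β E := by unfold gapSlope; rw [mul_div_assoc]; congr 2; ring

/-- Softmax is Lipschitz in total variation on the set where all the gaps are at least `b`. -/
lemma softmax_lipschitz {β b : ℝ} (hβ : 0 < β) (hb : 0 ≤ b) (hq : 2 < q)
    (hE : ((q : ℝ) + 1) * Real.exp (-β * b) ≤ 1) {x y : Fin q → ℝ} {i : Fin q}
    (hx : ∀ j, j ≠ i → b ≤ x i - x j) (hy : ∀ j, j ≠ i → b ≤ y i - y j)
    (hxy : ∑ k, x k = ∑ k, y k) {φ : Fin q → ℝ} (hφ : ∀ k, φ k = 0 ∨ φ k = 1) :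
    ∑ k, φ k * (softmax β x k - softmax β y k) ≤
      gapSlope q β (Real.exp (-β * b)) * ∑ k, |x k - y k| / 2 := by
  set w : Fin q → ℝ := fun k => x k - y k with hw
  have hw0 : ∑ k, w k = 0 := by simp [hw, Finset.sum_sub_distrib, hxy]
  -- The condition on the gaps is convex, so it holds along the whole segment from y to x and the
  -- mean value inequality applies.
  set z : ℝ → Fin q → ℝ := fun s k => y k + s * w k with hz
  set F : ℝ → ℝ := fun s => (∑ k, φ k * Real.exp (β * z s k)) / ∑ k, Real.exp (β * z s k) with hF
  have hexp : ∀ s k, HasDerivAt (fun s => Real.exp (β * z s k))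
      (Real.exp (β * z s k) * (β * w k)) s := by
    intro s k
    have : HasDerivAt (fun s => β * z s k) (β * w k) s := by
      simpa [hz] using (((hasDerivAt_id s).mul_const (w k)).const_add (y k)).const_mul β
    exact this.exp
  have hder : ∀ s, HasDerivAt F (∑ k, w k * (β * (softmax β (z s) k *
      (φ k - ∑ j, φ j * softmax β (z s) j)))) s := by
    intro s
    have hden := softmax_den_pos β i (z s)
    have hN : HasDerivAt (fun s => ∑ k, φ k * Real.exp (β * z s k))
        (∑ k, φ k * (Real.exp (β * z s k) * (β * w k))) s :=
      HasDerivAt.fun_sum fun k _ => (hexp s k).const_mul (φ k)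
    have hZ : HasDerivAt (fun s => ∑ k, Real.exp (β * z s k))
        (∑ k, (Real.exp (β * z s k) * (β * w k))) s :=
      HasDerivAt.fun_sum fun k _ => hexp s k
    refine HasDerivAt.congr_deriv (hN.div hZ hden.ne') ?_
    simp only [softmax]
    set Z := ∑ k, Real.exp (β * z s k) with hZdef
    set N := ∑ k, φ k * Real.exp (β * z s k) with hNdef
    have hN' : ∑ j, φ j * (Real.exp (β * z s j) / Z) = N / Z := by
      rw [hNdef, Finset.sum_div]
      exact Finset.sum_congr rfl fun _ _ => by ring
    rw [hN', Finset.sum_mul, Finset.mul_sum, ← Finset.sum_sub_distrib, Finset.sum_div]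
    refine Finset.sum_congr rfl fun k _ => ?_
    field_simp
  have hgapz : ∀ s, 0 ≤ s → s ≤ 1 → ∀ j, j ≠ i → b ≤ z s i - z s j := by
    intro s h0 h1 j hj
    have e : z s i - z s j = (1 - s) * (y i - y j) + s * (x i - x j) := by
      simp only [hz, hw]; ring
    rw [e]
    nlinarith [hx j hj, hy j hj]
  have hF1 : F 1 - F 0 = ∑ k, φ k * (softmax β x k - softmax β y k) := by
    have e1 : z 1 = x := by funext k; simp [hz, hw]
    have e0 : z 0 = y := by funext k; simp [hz]
    simp only [hF, e1, e0, softmax, mul_sub, Finset.sum_sub_distrib, Finset.sum_div, mul_div_assoc]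
  have := (convex_Icc (0 : ℝ) 1).image_sub_le_mul_sub_of_deriv_le
    (f := F) (C := gapSlope q β (Real.exp (-β * b)) * ∑ k, |w k| / 2)
    (fun s _ => (hder s).continuousAt.continuousWithinAt)
    (fun s _ => (hder s).differentiableAt.differentiableWithinAt)
    (fun s hs => by
      rw [interior_Icc] at hs
      rw [(hder s).deriv]
      refine sum_mul_le_of_sum_eq_zero hw0 fun k l => ?_
      rw [← mul_sub]
      exact softmax_oscillation_le hβ hb hq hE (hgapz s hs.1.le hs.2.le) hφ k l)
    0 (by simp) 1 (by simp) zero_le_one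
  rw [hF1] at this
  simpa using this

lemma sum_othersWithSpin_div (hn : 0 < n) (σ : Config n q) (v : Fin n) :
    ∑ k, (othersWithSpin σ v k : ℝ) / n = 1 - 1 / n := by
  have hn' : (n : ℝ) ≠ 0 := by exact_mod_cast hn.ne'
  simp only [othersWithSpin_div, Finset.sum_sub_distrib, proportions_eq_sum, ← Finset.sum_div]
  rw [Finset.sum_comm]
  simp [hn']

lemma hammingDist_eq_sum (σ σ' : Config n q) :
    (hammingDist σ σ' : ℝ) = ∑ u, if σ u ≠ σ' u then (1 : ℝ) else 0 := by
  rw [hammingDist, Finset.card_filter]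
  push_cast
  rfl

/-- Each disagreeing vertex alters at most two counts by one; the factor 1/2 compensates. -/
lemma othersWithSpin_dist_le (hn : 0 < n) (σ σ' : Config n q) (v : Fin n) :
    ∑ k, |(othersWithSpin σ v k : ℝ) / n - (othersWithSpin σ' v k : ℝ) / n| / 2 ≤
      (hammingDist σ σ' : ℝ) / n := by
  have hn' : (0 : ℝ) < n := by exact_mod_cast hn
  have hcast : ∀ (τ : Config n q) k, (othersWithSpin τ v k : ℝ) =
      ∑ u, if u ≠ v ∧ τ u = k then (1 : ℝ) else 0 := by
    intro τ k; simp [othersWithSpin]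
  have h1 : ∀ k, |(othersWithSpin σ v k : ℝ) / n - (othersWithSpin σ' v k : ℝ) / n| / 2 ≤
      (∑ u, if σ u ≠ σ' u then ((if σ u = k then (1 : ℝ) else 0) +
        (if σ' u = k then (1 : ℝ) else 0)) else 0) / (2 * n) := by
    intro k
    rw [← sub_div, abs_div, abs_of_pos hn', div_div, mul_comm (n : ℝ) 2, hcast, hcast,
      ← Finset.sum_sub_distrib]
    gcongr
    refine (Finset.abs_sum_le_sum_abs _ _).trans (Finset.sum_le_sum fun u _ => ?_)
    by_cases h : σ u = σ' u
    · simp [h]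
    · by_cases hu : u = v <;> by_cases h1 : σ u = k <;> by_cases h2 : σ' u = k <;>
        simp_all
  refine (Finset.sum_le_sum fun k _ => h1 k).trans ?_
  rw [← Finset.sum_div, Finset.sum_comm]
  have h2 : ∀ u, ∑ k, (if σ u ≠ σ' u then ((if σ u = k then (1 : ℝ) else 0) +
      (if σ' u = k then (1 : ℝ) else 0)) else 0) = 2 * if σ u ≠ σ' u then 1 else 0 := by
    intro u
    split_ifs
    · simp [Finset.sum_add_distrib]; norm_num
    · simp
  simp only [h2, ← Finset.mul_sum]
  rw [mul_div_mul_left _ _ two_ne_zero, hammingDist_eq_sum]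

lemma hammingDist_update (σ σ' : Config n q) (v : Fin n) (k k' : Fin q) :
    (hammingDist (Function.update σ v k) (Function.update σ' v k') : ℝ) =
      hammingDist σ σ' - (if σ v ≠ σ' v then 1 else 0) + (if k ≠ k' then 1 else 0) := by
  rw [hammingDist_eq_sum, hammingDist_eq_sum, ← Finset.add_sum_erase _ _ (Finset.mem_univ v), ← Finset.add_sum_erase (a := v)
    (f := fun u => if σ u ≠ σ' u then (1 : ℝ) else 0) _ (Finset.mem_univ v)]
  rw [Finset.sum_congr rfl (g := fun u => if σ u ≠ σ' u then (1 : ℝ) else 0)]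
  · rw [Function.update_self, Function.update_self]
    ring
  · intro u hu
    rw [Function.update_of_ne (Finset.ne_of_mem_erase hu),
      Function.update_of_ne (Finset.ne_of_mem_erase hu)]

/-- One step of the coupled dynamics contracts the Hamming distance when all the gaps of both
configurations exceed `b`. -/
lemma glauber_mulVec_sub_le {β b κ : ℝ} (hβ : 0 < β) (hb : 0 ≤ b) (hq : 2 < q) (hn : 0 < n)
    (hE : ((q : ℝ) + 1) * Real.exp (-β * b) ≤ 1) (hκ : gapSlope q β (Real.exp (-β * b)) ≤ κ)
    {f B : Config n q → ℝ} {R : ℝ} (hR : 0 ≤ R)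
    (hf : ∀ σ σ', |f σ - f σ'| ≤ R * hammingDist σ σ' + B σ + B σ')
    {i : Fin q} {σ σ' : Config n q} (hσ : ∀ j, j ≠ i → b + 1 / n ≤ gap i j σ)
    (hσ' : ∀ j, j ≠ i → b + 1 / n ≤ gap i j σ') :
    (glauber n q β).mulVec f σ - (glauber n q β).mulVec f σ' ≤
      R * (1 - (1 - κ) / n) * hammingDist σ σ' +
        (glauber n q β).mulVec B σ + (glauber n q β).mulVec B σ' := by
  have hn' : (0 : ℝ) < n := by exact_mod_cast hn
  -- Both copies update the same vertex, with maximally coupled new spins. A disagreement is erased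
  -- with probability 1/n and one is created with probability at most κ/n times the current
  -- distance.
  choose p φ hp0 hp1 hp2 hφ hp3 using fun v => exists_maximal_coupling
    (r := resampleProb β σ v) (r' := resampleProb β σ' v) (resampleProb_nonneg β σ v)
    (resampleProb_nonneg β σ' v)
    ((sum_resampleProb (by omega) β σ v).trans (sum_resampleProb (by omega) β σ' v).symm)
  have hleft : ∀ h : Config n q → ℝ, (glauber n q β).mulVec h σ =
      ∑ v, ∑ k, ∑ k', (1 / (n : ℝ)) * p v k k' * h (Function.update σ v k) := by
    intro h
    rw [glauber_mulVec]
    refine Finset.sum_congr rfl fun v _ => Finset.sum_congr rfl fun k _ => ?_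
    rw [← hp1 v k, Finset.mul_sum, Finset.sum_mul]
  have hright : ∀ h : Config n q → ℝ, (glauber n q β).mulVec h σ' =
      ∑ v, ∑ k, ∑ k', (1 / (n : ℝ)) * p v k k' * h (Function.update σ' v k') := by
    intro h
    rw [glauber_mulVec]
    refine Finset.sum_congr rfl fun v _ => ?_
    rw [Finset.sum_comm]
    refine Finset.sum_congr rfl fun k _ => ?_
    rw [← hp2 v k, Finset.mul_sum, Finset.sum_mul]
  have hmass : ∀ v, ∑ k, ∑ k', p v k k' = 1 := by
    intro v
    simp only [hp1, sum_resampleProb (show 0 < q by omega)]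
  have hoff : ∀ v, ∑ k, ∑ k', p v k k' * (if k ≠ k' then 1 else 0) ≤
      κ * ((hammingDist σ σ' : ℝ) / n) := by
    intro v
    refine (hp3 v).trans ?_
    simp only [resampleProb_eq_softmax]
    refine (softmax_lipschitz hβ hb hq hE (i := i) (fun j hj => ?_) (fun j hj => ?_) ?_
      (hφ v)).trans ?_
    · linarith [hσ j hj, others_gap_ge σ v i j]
    · linarith [hσ' j hj, others_gap_ge σ' v i j]
    · rw [sum_othersWithSpin_div hn, sum_othersWithSpin_div hn]
    · refine mul_le_mul hκ (othersWithSpin_dist_le hn σ σ' v)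
        (Finset.sum_nonneg fun _ _ => by positivity) (le_trans ?_ hκ)
      have := gapMap_den_pos hq (Real.exp_pos (-β * b))
      unfold gapSlope
      positivity
  have hterm : ∀ v, ∑ k, ∑ k', (1 / (n : ℝ)) * p v k k' *
      (R * hammingDist (Function.update σ v k) (Function.update σ' v k')) ≤
      R / n * (hammingDist σ σ' - (if σ v ≠ σ' v then 1 else 0) +
        κ * ((hammingDist σ σ' : ℝ) / n)) := by
    intro v
    have : ∑ k, ∑ k', (1 / (n : ℝ)) * p v k k' *
      (R * hammingDist (Function.update σ v k) (Function.update σ' v k')) =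
      R / n * ((hammingDist σ σ' - (if σ v ≠ σ' v then 1 else 0)) * ∑ k, ∑ k', p v k k' +
        ∑ k, ∑ k', p v k k' * (if k ≠ k' then 1 else 0)) := by
      simp only [hammingDist_update, Finset.mul_sum, ← Finset.sum_add_distrib]
      refine Finset.sum_congr rfl fun k _ => Finset.sum_congr rfl fun k' _ => ?_
      ring
    rw [this, hmass, mul_one]
    have := hoff v
    gcongr
  have hdist : ∑ v, (if σ v ≠ σ' v then (1 : ℝ) else 0) = hammingDist σ σ' :=
    (hammingDist_eq_sum σ σ').symm
  have hsum : ∑ v, ∑ k, ∑ k', (1 / (n : ℝ)) * p v k k' *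
      (R * hammingDist (Function.update σ v k) (Function.update σ' v k')) ≤
      R * (1 - (1 - κ) / n) * hammingDist σ σ' := by
    refine (Finset.sum_le_sum fun v _ => hterm v).trans (le_of_eq ?_)
    rw [← Finset.mul_sum, Finset.sum_add_distrib, Finset.sum_sub_distrib, hdist]
    simp
    field_simp
    ring
  rw [hleft f, hright f, hleft B, hright B]
  refine le_trans ?_ (add_le_add_left (add_le_add_left hsum _) _)
  simp only [← Finset.sum_add_distrib, ← Finset.sum_sub_distrib]
  refine Finset.sum_le_sum fun v _ => Finset.sum_le_sum fun k _ => Finset.sum_le_sum fun k' _ => ?_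
  simp only [← mul_sub, ← mul_add]
  exact mul_le_mul_of_nonneg_left ((le_abs_self _).trans (hf _ _))
    (mul_nonneg (by positivity) (hp0 v k k'))

/-! ### A Lyapunov function for the gaps -/

/-- Sum of negative powers of the gaps, truncated at `δ / 2`. -/
noncomputable def gapPot (i : Fin q) (δ : ℝ) (P : ℕ) (σ : Config n q) : ℝ :=
  ∑ j ∈ Finset.univ.erase i, ((max (gap i j σ) (δ / 2))⁻¹) ^ P

lemma gapPot_nonneg (i : Fin q) {δ : ℝ} (hδ : 0 < δ) (P : ℕ) (σ : Config n q) :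
    0 ≤ gapPot i δ P σ :=
  Finset.sum_nonneg fun j _ => by
    have : 0 < max (gap i j σ) (δ / 2) := lt_max_of_lt_right (by linarith)
    positivity

/-- The potential is large when some gap is small. -/
lemma one_le_pow_mul_gapPot {i : Fin q} {δ s : ℝ} (hδ : 0 < δ) (hs : δ / 2 ≤ s) (P : ℕ)
    {σ : Config n q} (h : ¬ ∀ j, j ≠ i → s ≤ gap i j σ) : 1 ≤ s ^ P * gapPot i δ P σ := by
  push Not at h
  obtain ⟨j, hj, hlt⟩ := h
  have hpos : ∀ l, 0 < max (gap i l σ) (δ / 2) := fun l => lt_max_of_lt_right (by linarith)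
  have h1 : ((max (gap i j σ) (δ / 2))⁻¹) ^ P ≤ gapPot i δ P σ :=
    Finset.single_le_sum (f := fun j => ((max (gap i j σ) (δ / 2))⁻¹) ^ P)
      (fun l _ => by have := hpos l; positivity) (Finset.mem_erase.2 ⟨hj, Finset.mem_univ j⟩)
  have h2 : max (gap i j σ) (δ / 2) ≤ s := max_le hlt.le hs
  calc 1 ≤ (s * (max (gap i j σ) (δ / 2))⁻¹) ^ P := by
        apply one_le_pow₀
        rw [← div_eq_mul_inv, le_div_iff₀ (hpos j), one_mul]
        exact h2
    _ = s ^ P * ((max (gap i j σ) (δ / 2))⁻¹) ^ P := mul_pow _ _ _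
    _ ≤ _ := by
        have : 0 ≤ s := by linarith
        gcongr

lemma gapPot_le {i : Fin q} {δ s : ℝ} (hs : 0 < s) (P : ℕ) {σ : Config n q}
    (h : ∀ j, j ≠ i → s ≤ gap i j σ) : gapPot i δ P σ ≤ q * (s⁻¹) ^ P := by
  have h1 : gapPot i δ P σ ≤ ∑ _j ∈ Finset.univ.erase i, (s⁻¹) ^ P := by
    refine Finset.sum_le_sum fun j hj => ?_
    have h2 : s ≤ max (gap i j σ) (δ / 2) :=
      (h j (Finset.ne_of_mem_erase hj)).trans (le_max_left _ _)
    have : 0 < max (gap i j σ) (δ / 2) := hs.trans_le h2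
    gcongr
  refine h1.trans ?_
  rw [Finset.sum_const, nsmul_eq_mul]
  have : ((Finset.univ.erase i).card : ℝ) ≤ q := by
    exact_mod_cast (Finset.card_le_univ _).trans (by simp)
  gcongr

/-- Bernoulli's inequality gives (y/x)^P ≥ 1 + w with w = P(y - x)/x, and 1/(1 + w) ≤ 1 - w + 2w²
for |w| ≤ 1/2. The estimate is uniform in P, which later grows with n. -/
lemma inv_pow_le_quadratic {x y : ℝ} {P : ℕ} (hx : 0 < x) (hy : 0 < y)
    (h : |P * ((y - x) / x)| ≤ 1 / 2) :
    (y⁻¹) ^ P ≤ (x⁻¹) ^ P *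
      (1 - P * ((y - x) / x) + 2 * (P * ((y - x) / x)) ^ 2) := by
  set u := (y - x) / x with hu
  have hyx : y = x * (1 + u) := by rw [hu]; field_simp; ring
  have h1u : 0 < 1 + u := by
    rw [hyx] at hy
    exact pos_of_mul_pos_right hy hx.le
  have hb : 1 + P * u ≤ (1 + u) ^ P := one_add_mul_le_pow (by linarith) P
  obtain ⟨h1, h2⟩ := abs_le.1 h
  rw [hyx, mul_inv, mul_pow]
  gcongr
  rw [inv_pow]
  set w := P * u
  have hw : 0 < 1 + w := by linarith
  calc ((1 + u) ^ P)⁻¹ ≤ (1 + w)⁻¹ := by gcongr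
    _ ≤ 1 - w + 2 * w ^ 2 := by
      rw [inv_eq_one_div, div_le_iff₀ hw]
      nlinarith [mul_nonneg (sq_nonneg w) (by linarith : (0 : ℝ) ≤ 1 + 2 * w)]

/-- One-step bound for a single term of the potential. -/
lemma glauber_mulVec_inv_pow_le {β c δ D : ℝ} (hn : 0 < n) (hq : 0 < q) (hc0 : 0 < c) (hc1 : c ≤ 1)
    (hδ0 : 0 < δ) (hδ1 : δ ≤ 1) {P : ℕ} (hP : 1 ≤ P) (hK : 128 / c * P ≤ n * δ ^ 2)
    {i j : Fin q} {σ : Config n q} (hσ : δ ≤ gap i j σ)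
    (hD : gap i j σ + D / n ≤ (glauber n q β).mulVec (gap i j) σ) :
    (glauber n q β).mulVec (fun τ => ((max (gap i j τ) (δ / 2))⁻¹) ^ P) σ ≤
      ((gap i j σ)⁻¹) ^ P * (1 + c / 16 * (P / n) - P / n * (D / gap i j σ)) := by
  have hn' : (0 : ℝ) < n := by exact_mod_cast hn
  have hP' : (1 : ℝ) ≤ P := by exact_mod_cast hP
  set x := gap i j σ with hx
  have hx0 : 0 < x := hδ0.trans_le hσ
  have hcK : 128 * (P : ℝ) ≤ c * (n * δ ^ 2) := by
    rw [div_mul_eq_mul_div, div_le_iff₀ hc0] at hK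
    linarith
  have hnδ2 : (n : ℝ) * δ ^ 2 ≤ n * δ := by
    rw [pow_two, ← mul_assoc]; exact mul_le_of_le_one_right (by positivity) hδ1
  have hnδ : 128 * (P : ℝ) ≤ n * δ := by
    have : c * (n * δ ^ 2) ≤ 1 * (n * δ ^ 2) := by gcongr
    linarith
  have h2n : 2 / (n : ℝ) ≤ δ / 2 := by
    rw [div_le_iff₀ hn']; linarith
  set s : ℝ := -((x⁻¹) ^ P * (P / x)) with hs
  set u : ℝ := (x⁻¹) ^ P * (1 + P + c / 16 * (P / n)) with hu
  -- The slope s is that of x ↦ x^(-P). One step moves a gap by at most 2/n ≤ δ/2, so the truncation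
  -- is inactive after the update.
  have hup : ∀ v k, (fun τ => ((max (gap i j τ) (δ / 2))⁻¹) ^ P) (Function.update σ v k) ≤
      (fun τ => s * gap i j τ + u) (Function.update σ v k) := by
    intro v k
    have hΔ := abs_gap_update_sub_le σ v k i j
    simp only
    set y := gap i j (Function.update σ v k)
    rw [← hx] at hΔ
    have hyl : δ / 2 ≤ y := by linarith [(abs_le.1 hΔ).1]
    rw [max_eq_left hyl]
    have hrel : |P * ((y - x) / x)| ≤ P * (2 / (n * δ)) := by
      rw [abs_mul, abs_of_nonneg (by positivity), abs_div, abs_of_pos hx0, ← div_div]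
      gcongr
    have hsmall : (P : ℝ) * (2 / (n * δ)) ≤ 1 / 2 := by
      rw [mul_div_assoc', div_le_iff₀ (by positivity)]; linarith
    -- The constant 128 in `hK` is chosen here: the noise 8P/(nδ²) must not exceed c/16.
    have hsq : 2 * (P * ((y - x) / x)) ^ 2 ≤ c / 16 * (P / n) := by
      calc 2 * (P * ((y - x) / x)) ^ 2 ≤ 2 * (P * (2 / (n * δ))) ^ 2 := by
            rw [← sq_abs]; gcongr
        _ = P / n * (8 * P / (n * δ ^ 2)) := by field_simp; ring
        _ ≤ P / n * (c / 16) := by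
            refine mul_le_mul_of_nonneg_left ?_ (by positivity)
            rw [div_le_iff₀ (by positivity)]
            linarith
        _ = c / 16 * (P / n) := by ring
    refine (inv_pow_le_quadratic hx0 (by linarith) (hrel.trans hsmall)).trans ?_
    have : (x⁻¹) ^ P * (1 - P * ((y - x) / x) + 2 * (P * ((y - x) / x)) ^ 2) ≤
        (x⁻¹) ^ P * (1 - P * ((y - x) / x) + c / 16 * (P / n)) := by gcongr
    refine this.trans (le_of_eq ?_)
    rw [hs, hu, sub_div, div_self hx0.ne']
    ring
  refine (glauber_mulVec_mono β (g := fun τ => s * gap i j τ + u) hup).trans ?_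
  rw [mulVec_affine_of_stochastic (glauber_mem_rowStochastic hn hq β)]
  have hs0 : s ≤ 0 := neg_nonpos.2 (by positivity)
  have h1 := mul_le_mul_of_nonpos_left hD hs0
  refine (add_le_add_left h1 u).trans (le_of_eq ?_)
  rw [hs, hu]
  field_simp
  ring

/-- The potential contracts, up to a small error, as long as all the gaps are at least `δ`. -/
lemma glauber_mulVec_gapPot_le {β a c δ : ℝ} (hβ : 0 < β) (hq : 2 < q) (hn : 0 < n) (ha : 0 < a)
    (hc0 : 0 < c) (hc1 : c ≤ 1)
    (hexpand : ∀ x, 0 ≤ x → x ≤ a → (1 + c) * x ≤ gapMap q β x)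
    {P : ℕ} (hP : 1 ≤ P) (hPq : 2 * q * ((1 + c / 4) / (1 + c / 2)) ^ P ≤ c / 4)
    (hδ0 : 0 < δ) (hδ1 : δ ≤ 1) (hK : 128 / c * P ≤ n * δ ^ 2)
    {i : Fin q} {σ : Config n q} (hσ : ∀ j, j ≠ i → δ ≤ gap i j σ) :
    (glauber n q β).mulVec (gapPot i δ P) σ ≤
      (1 - c / 8 * (P / n)) * gapPot i δ P σ + 2 * q * (P / n) * (a⁻¹) ^ P := by
  have hn' : (0 : ℝ) < n := by exact_mod_cast hn
  have hP' : (1 : ℝ) ≤ P := by exact_mod_cast hP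
  have hcard : (Finset.univ.erase i).card = q - 1 := by simp
  have hne : (Finset.univ.erase i).Nonempty := by rw [← Finset.card_pos, hcard]; omega
  obtain ⟨m, hm, hmin⟩ := Finset.exists_min_image _ (fun j => gap i j σ) hne
  set d := gap i m σ with hd
  have hmin' : ∀ j, j ≠ i → d ≤ gap i j σ := fun j hj =>
    hmin j (Finset.mem_erase.2 ⟨hj, Finset.mem_univ j⟩)
  have hδd : δ ≤ d := hσ m (Finset.ne_of_mem_erase hm)
  have hd0 : 0 < d := hδ0.trans_le hδd
  have hnd : 128 / c ≤ n * d := by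
    have h1 : (n : ℝ) * δ ^ 2 ≤ n * δ := by
      rw [pow_two, ← mul_assoc]; exact mul_le_of_le_one_right (by positivity) hδ1
    have h2 : (n : ℝ) * δ ≤ n * d := by gcongr
    have h3 : 128 / c * 1 ≤ 128 / c * P := by gcongr
    linarith
  have hcnd : 128 / (n : ℝ) ≤ c * d := by
    rw [div_le_iff₀ hc0] at hnd
    rw [div_le_iff₀ hn']
    linarith
  have hnd1 : 1 / (n : ℝ) ≤ d := by
    have h1 : 128 / (n : ℝ) = 128 * (1 / n) := by ring
    have h2 : c * d ≤ 1 * d := by gcongr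
    have h3 : (0 : ℝ) ≤ 1 / n := by positivity
    linarith
  set ψ : Fin q → ℝ := fun j => ((gap i j σ)⁻¹) ^ P with hψ
  have hgpos : ∀ j, j ≠ i → 0 < gap i j σ := fun j hj => hd0.trans_le (hmin' j hj)
  have hψ0 : ∀ j ∈ Finset.univ.erase i, 0 ≤ ψ j := fun j hj => by
    have := hgpos j (Finset.ne_of_mem_erase hj)
    positivity
  have hpot : gapPot i δ P σ = ∑ j ∈ Finset.univ.erase i, ψ j := by
    refine Finset.sum_congr rfl fun j hj => ?_
    rw [max_eq_left]
    linarith [hσ j (Finset.ne_of_mem_erase hj)]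
  set h := gapMap q β (d - 1 / n) with hh
  have hstep : (glauber n q β).mulVec (gapPot i δ P) σ ≤ ∑ j ∈ Finset.univ.erase i,
      ψ j * (1 + c / 16 * (P / n) - P / n * ((h - gap i j σ) / gap i j σ)) := by
    have : (glauber n q β).mulVec (gapPot i δ P) σ = ∑ j ∈ Finset.univ.erase i,
        (glauber n q β).mulVec (fun τ => ((max (gap i j τ) (δ / 2))⁻¹) ^ P) σ := by
      simp only [Matrix.mulVec, dotProduct, gapPot, Finset.mul_sum]
      exact Finset.sum_comm
    rw [this]
    refine Finset.sum_le_sum fun j hj => ?_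
    have hji := Finset.ne_of_mem_erase hj
    exact glauber_mulVec_inv_pow_le hn (by omega) hc0 hc1 hδ0 hδ1 hP hK (hσ j hji)
      (glauber_mulVec_gap_ge hβ hq hn hji hnd1 hmin')
  refine hstep.trans ?_
  have hPn : 0 ≤ (P : ℝ) / n := by positivity
  rcases le_total d a with hda | hda
  · have hh1 : (1 + c / 2) * d ≤ h := by
      have h1 := hexpand (d - 1 / n) (by linarith)
        (by have : (0 : ℝ) ≤ 1 / n := by positivity
            linarith)
      have h2 : (1 + c) * (1 / (n : ℝ)) ≤ c / 2 * d := by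
        have h1 : 128 / (n : ℝ) = 128 * (1 / n) := by ring
        have h3 : (1 + c) * (1 / (n : ℝ)) ≤ 2 * (1 / n) := by gcongr; linarith
        have h4 : (0 : ℝ) ≤ 1 / n := by positivity
        linarith
      linarith
    set ρ : ℝ := (1 + c / 4) / (1 + c / 2) with hρ
    have hρ0 : 0 < ρ := by positivity
    -- Only the smallest gap d is sure to grow. A gap with d/gap ≥ ρ does no harm, while larger gaps
    -- may shrink but weigh at most ρ^P relative to the m-th term. Their total is absorbed by the
    -- surplus c/4 of that term through `hPq`.
    have hterm : ∀ j ∈ Finset.univ.erase i,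
        -(2 * ρ ^ P * ψ m) ≤ ψ j * ((1 + c / 2) * (d / gap i j σ) - (1 + c / 4)) := by
      intro j hj
      have hgj := hgpos j (Finset.ne_of_mem_erase hj)
      have hψj := hψ0 j hj
      have hψm := hψ0 m hm
      set x := d / gap i j σ with hx
      have hx0 : 0 < x := by positivity
      have hψx : ψ j = ψ m * x ^ P := by
        simp only [hψ, hx, ← hd, ← mul_pow]
        congr 1
        field_simp
      rcases le_total ρ x with hρx | hρx
      · have : 1 + c / 4 ≤ (1 + c / 2) * x := by
          rw [hρ, div_le_iff₀ (by positivity)] at hρx; linarith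
        have h1 : 0 ≤ ψ j * ((1 + c / 2) * x - (1 + c / 4)) := mul_nonneg hψj (by linarith)
        have h2 : 0 ≤ 2 * ρ ^ P * ψ m := by positivity
        linarith
      · have h1 : -(ψ j * 2) ≤ ψ j * ((1 + c / 2) * x - (1 + c / 4)) := by
          rw [← mul_neg]
          refine mul_le_mul_of_nonneg_left ?_ hψj
          have : 0 ≤ (1 + c / 2) * x := by positivity
          linarith
        have h2 : ψ j ≤ ψ m * ρ ^ P := by rw [hψx]; gcongr
        linarith
    have hmain : 0 ≤ ∑ j ∈ Finset.univ.erase i,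
        ψ j * ((1 + c / 2) * (d / gap i j σ) - (1 + c / 4)) := by
      rw [← Finset.add_sum_erase _ _ hm, ← hd, div_self hd0.ne']
      have h1 := Finset.card_nsmul_le_sum ((Finset.univ.erase i).erase m) _ _
        (fun j hj => hterm j (Finset.mem_of_mem_erase hj))
      rw [nsmul_eq_mul] at h1
      have h2 : (((Finset.univ.erase i).erase m).card : ℝ) ≤ q := by
        exact_mod_cast (Finset.card_le_univ _).trans (by simp)
      have hψm := hψ0 m hm
      have h3 : (((Finset.univ.erase i).erase m).card : ℝ) * (2 * ρ ^ P * ψ m) ≤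
          q * (2 * ρ ^ P * ψ m) := by gcongr
      have h4 : 2 * q * ρ ^ P * ψ m ≤ c / 4 * ψ m := by gcongr
      linarith
    have hexp : ∀ j ∈ Finset.univ.erase i,
        ψ j * (1 + c / 16 * (P / n) - P / n * ((h - gap i j σ) / gap i j σ)) ≤
        (1 - c / 8 * (P / n)) * ψ j -
          P / n * (ψ j * ((1 + c / 2) * (d / gap i j σ) - (1 + c / 4))) := by
      intro j hj
      have hgj := hgpos j (Finset.ne_of_mem_erase hj)
      have hψj := hψ0 j hj
      have h1 : (1 + c / 2) * (d / gap i j σ) - 1 ≤ (h - gap i j σ) / gap i j σ := by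
        rw [sub_div, div_self hgj.ne', mul_div_assoc']
        gcongr
      have h2 : P / n * ψ j * ((1 + c / 2) * (d / gap i j σ) - 1) ≤
          P / n * ψ j * ((h - gap i j σ) / gap i j σ) :=
        mul_le_mul_of_nonneg_left h1 (by positivity)
      have h3 : 0 ≤ c * (P / n * ψ j) := by positivity
      linarith
    refine (Finset.sum_le_sum hexp).trans ?_
    rw [Finset.sum_sub_distrib, ← Finset.mul_sum, ← Finset.mul_sum, ← hpot]
    have h1 := mul_nonneg hPn hmain
    have h2 : 0 ≤ 2 * q * ((P : ℝ) / n) * (a⁻¹) ^ P := by positivity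
    linarith
  -- When every gap is at least a, no growth is available, but each term is at most a^(-P), which
  -- becomes the additive error.
  · have hh0 : 0 ≤ h := gapMap_nonneg hq hβ (by linarith)
    have hexp : ∀ j ∈ Finset.univ.erase i,
        ψ j * (1 + c / 16 * (P / n) - P / n * ((h - gap i j σ) / gap i j σ)) ≤
        (1 - c / 8 * (P / n)) * ψ j + 2 * (P / n) * (a⁻¹) ^ P := by
      intro j hj
      have hji := Finset.ne_of_mem_erase hj
      have hgj := hgpos j hji
      have hψj := hψ0 j hj
      have h1 : -1 ≤ (h - gap i j σ) / gap i j σ := by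
        rw [le_div_iff₀ hgj]; linarith
      have h2 : P / n * ψ j * (-1) ≤ P / n * ψ j * ((h - gap i j σ) / gap i j σ) :=
        mul_le_mul_of_nonneg_left h1 (by positivity)
      have h3 : ψ j ≤ (a⁻¹) ^ P := by
        have := hda.trans (hmin' j hji)
        simp only [hψ]
        gcongr
      have h4 : (P : ℝ) / n * ψ j ≤ P / n * (a⁻¹) ^ P := by gcongr
      have h5 : c * (P / n * ψ j) ≤ 1 * (P / n * ψ j) := by gcongr
      have h6 : 0 ≤ (P : ℝ) / n * (a⁻¹) ^ P := by positivity
      linarith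
    refine (Finset.sum_le_sum hexp).trans ?_
    rw [Finset.sum_add_distrib, ← Finset.mul_sum, ← hpot, Finset.sum_const, nsmul_eq_mul]
    have h2 : ((Finset.univ.erase i).card : ℝ) ≤ q := by
      exact_mod_cast (Finset.card_le_univ _).trans (by simp)
    have h3 : ((Finset.univ.erase i).card : ℝ) * (2 * (P / n) * (a⁻¹) ^ P) ≤
        q * (2 * (P / n) * (a⁻¹) ^ P) := by gcongr
    linarith

/-! ### Combining the growth of the gaps with the contraction -/

lemma abs_pow_mulVec_sub_le_one (hn : 0 < n) (hq : 0 < q) (β : ℝ) {F : Config n q → ℝ}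
    (hF0 : ∀ σ, 0 ≤ F σ) (hF1 : ∀ σ, F σ ≤ 1) (t : ℕ) (σ σ' : Config n q) :
    |(glauber n q β ^ t).mulVec F σ - (glauber n q β ^ t).mulVec F σ'| ≤ 1 := by
  have hA := pow_mem (glauber_mem_rowStochastic hn hq β) t
  have h1 := mulVec_mem_unit_of_stochastic hA hF0 hF1 σ
  have h2 := mulVec_mem_unit_of_stochastic hA hF0 hF1 σ'
  rw [abs_le]
  constructor <;> linarith [h1.1, h1.2, h2.1, h2.2]

/-- Iterated contraction, with the potential accounting for exits from the region of contraction. -/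
lemma abs_pow_mulVec_sub_le_hamming {β b b' κ δ l e : ℝ} (hβ : 0 < β) (hb : 0 ≤ b) (hq : 2 < q)
    (hn : 0 < n) (hE : ((q : ℝ) + 1) * Real.exp (-β * b) ≤ 1)
    (hκ : gapSlope q β (Real.exp (-β * b)) ≤ κ) (hκ0 : 0 ≤ κ) (hbb : b + 1 / n ≤ b')
    (hδ0 : 0 < δ) (hδ : δ ≤ b') (hl : l ≤ 1) (he : 0 ≤ e) {P : ℕ} {i : Fin q}
    (hdrift : ∀ σ : Config n q, (∀ j, j ≠ i → δ ≤ gap i j σ) →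
      (glauber n q β).mulVec (gapPot i δ P) σ ≤ l * gapPot i δ P σ + e)
    {F : Config n q → ℝ} (hF0 : ∀ σ, 0 ≤ F σ) (hF1 : ∀ σ, F σ ≤ 1) (t : ℕ) (σ σ' : Config n q) :
    |(glauber n q β ^ t).mulVec F σ - (glauber n q β ^ t).mulVec F σ'| ≤
      (1 - (1 - κ) / n) ^ t * hammingDist σ σ' + (b' ^ P * gapPot i δ P σ + t * (b' ^ P * e)) +
        (b' ^ P * gapPot i δ P σ' + t * (b' ^ P * e)) := by
  have hn1 : (1 : ℝ) ≤ n := by exact_mod_cast hn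
  have hb'0 : 0 < b' := hδ0.trans_le hδ
  set θ := b' ^ P with hθ
  have hθ0 : 0 < θ := by positivity
  have hρ : 0 ≤ 1 - (1 - κ) / n := by
    rw [sub_nonneg, div_le_one (by linarith)]; linarith
  have hΨ : ∀ σ : Config n q, 0 ≤ gapPot i δ P σ := gapPot_nonneg i hδ0 P
  have hA := glauber_mem_rowStochastic hn (show 0 < q by omega) β
  induction t generalizing σ σ' with
  | zero =>
    have h1 : |F σ - F σ'| ≤ hammingDist σ σ' := by
      by_cases h : σ = σ'
      · simp [h]
      · have : (1 : ℝ) ≤ hammingDist σ σ' := by exact_mod_cast hammingDist_pos.2 h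
        rw [abs_le]
        constructor <;> linarith [hF0 σ, hF1 σ, hF0 σ', hF1 σ']
    have h2 := mul_nonneg hθ0.le (hΨ σ)
    have h3 := mul_nonneg hθ0.le (hΨ σ')
    simp only [pow_zero, Matrix.one_mulVec, Nat.cast_zero, zero_mul, add_zero, one_mul]
    linarith
  | succ t ih =>
    have hd0 : (0 : ℝ) ≤ (1 - (1 - κ) / n) ^ (t + 1) * hammingDist σ σ' := by positivity
    have hte : 0 ≤ ((t + 1 : ℕ) : ℝ) * (θ * e) := by positivity
    have hΨσ := mul_nonneg hθ0.le (hΨ σ)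
    have hΨσ' := mul_nonneg hθ0.le (hΨ σ')
    -- If some gap is below b', the potential term alone is at least 1 and the claim is trivial;
    -- otherwise both copies lie in the contracting region.
    by_cases h : ∀ j, j ≠ i → b' ≤ gap i j σ
    swap
    · have h1 := one_le_pow_mul_gapPot hδ0 (by linarith) P h
      have h2 := abs_pow_mulVec_sub_le_one hn (show 0 < q by omega) β hF0 hF1 (t + 1) σ σ'
      linarith
    by_cases h' : ∀ j, j ≠ i → b' ≤ gap i j σ'
    swap
    · have h1 := one_le_pow_mul_gapPot hδ0 (by linarith) P h'
      have h2 := abs_pow_mulVec_sub_le_one hn (show 0 < q by omega) β hF0 hF1 (t + 1) σ σ'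
      linarith
    set B : Config n q → ℝ := fun σ => θ * gapPot i δ P σ + t * (θ * e) with hB
    have hBstep : ∀ σ : Config n q, (∀ j, j ≠ i → b' ≤ gap i j σ) →
        (glauber n q β).mulVec B σ ≤ θ * gapPot i δ P σ + ((t + 1 : ℕ) : ℝ) * (θ * e) := by
      intro σ hσ
      rw [hB, mulVec_affine_of_stochastic hA]
      have h1 := mul_le_mul_of_nonneg_left (hdrift σ fun j hj => hδ.trans (hσ j hj)) hθ0.le
      have h2 : θ * (l * gapPot i δ P σ) ≤ θ * (1 * gapPot i δ P σ) := by
        have := hΨ σ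
        gcongr
      push_cast
      linarith
    have key : ∀ σ σ' : Config n q, (∀ j, j ≠ i → b' ≤ gap i j σ) →
        (∀ j, j ≠ i → b' ≤ gap i j σ') → _ := fun σ σ' h h' =>
      glauber_mulVec_sub_le hβ hb hq hn hE hκ (pow_nonneg hρ t) ih (i := i) (σ := σ) (σ' := σ')
      (fun j hj => hbb.trans (h j hj)) (fun j hj => hbb.trans (h' j hj))
    rw [pow_succ_mulVec, abs_le, pow_succ]
    have k1 := key σ σ' h h'
    have k2 := key σ' σ h' h
    rw [hammingDist_comm] at k2
    have b1 := hBstep σ h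
    have b2 := hBstep σ' h'
    constructor <;> linarith

/-- The three phases: growth of the gaps to `η`, growth of the gaps beyond `b'`, contraction. -/
lemma abs_pow_mulVec_sub_le_of_biased {β b b' κ : ℝ} (hβ : 0 < β) (hb : 0 ≤ b) (hq : 2 < q)
    (hn : 0 < n) (hE : ((q : ℝ) + 1) * Real.exp (-β * b) ≤ 1)
    (hκ : gapSlope q β (Real.exp (-β * b)) ≤ κ) (hκ0 : 0 ≤ κ) (hbb : b + 1 / n ≤ b')
    {i : Fin q} {P p : ℕ} {η δ l e l' e' g : ℝ}
    (hη : 0 < η) (hηb : η / 2 ≤ b') (hl0 : 0 ≤ l) (hl : l ≤ 1) (he : 0 ≤ e)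
    (hdrift : ∀ σ : Config n q, (∀ j, j ≠ i → η / 2 ≤ gap i j σ) →
      (glauber n q β).mulVec (gapPot i (η / 2) P) σ ≤ l * gapPot i (η / 2) P σ + e)
    (hδ : 0 < δ) (hδη : δ / 2 ≤ η) (hl0' : 0 ≤ l') (hl' : l' ≤ 1) (he' : 0 ≤ e')
    (hdrift' : ∀ σ : Config n q, (∀ j, j ≠ i → δ ≤ gap i j σ) →
      (glauber n q β).mulVec (gapPot i δ p) σ ≤ l' * gapPot i δ p σ + e')
    {F : Config n q → ℝ} (hF0 : ∀ σ, 0 ≤ F σ) (hF1 : ∀ σ, F σ ≤ 1) (t : ℕ) (hg : 0 < g)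
    {σ σ' : Config n q} (hσ : ∀ j, j ≠ i → g ≤ gap i j σ) (hσ' : ∀ j, j ≠ i → g ≤ gap i j σ') :
    |(glauber n q β ^ (t + t + t)).mulVec F σ - (glauber n q β ^ (t + t + t)).mulVec F σ'| ≤
      (1 - (1 - κ) / n) ^ t * n + 2 * ((η ^ p * l' ^ t + δ ^ p) * (q * (g⁻¹) ^ p) +
        t * ((η ^ p + δ ^ p) * e') +
        ((b' ^ P * l ^ t + (η / 2) ^ P) * (q * (η⁻¹) ^ P) +
          t * ((2 * b' ^ P + (η / 2) ^ P) * e))) := by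
  have hn1 : (1 : ℝ) ≤ n := by exact_mod_cast hn
  have hb'0 : 0 < b' := by linarith
  have hA := glauber_mem_rowStochastic hn (show 0 < q by omega) β
  set M := glauber n q β with hM
  have hρ : 0 ≤ 1 - (1 - κ) / n := by
    rw [sub_nonneg, div_le_one (by linarith)]; linarith
  set w : ℝ := (1 - (1 - κ) / n) ^ t * n with hw
  have hw0 : 0 ≤ w := by positivity
  set Ψ : Config n q → ℝ := gapPot i (η / 2) P with hΨdef
  have hΨ : ∀ σ, 0 ≤ Ψ σ := gapPot_nonneg i (by linarith) P
  -- Truncation at 1 makes the failure bound itself a test function in [0, 1], so it can be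
  -- propagated backwards through the two growth phases by `pow_mulVec_le_of_drift`.
  set B : Config n q → ℝ := fun σ => min 1 (b' ^ P * Ψ σ + t * (b' ^ P * e)) with hB
  have hB0 : ∀ σ, 0 ≤ B σ := fun σ => le_min zero_le_one (by have := hΨ σ; positivity)
  have hB1 : ∀ σ, B σ ≤ 1 := fun σ => min_le_left _ _
  have hcontr : ∀ σ σ', |(M ^ t).mulVec F σ - (M ^ t).mulVec F σ'| ≤ w + B σ + B σ' := by
    intro σ σ'
    have h1 := abs_pow_mulVec_sub_le_one hn (show 0 < q by omega) β hF0 hF1 t σ σ'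
    have h2 := abs_pow_mulVec_sub_le_hamming hβ hb hq hn hE hκ hκ0 hbb (by linarith) hηb hl he
      hdrift hF0 hF1 t σ σ'
    have h3 : (1 - (1 - κ) / n) ^ t * hammingDist σ σ' ≤ w := by
      rw [hw]
      gcongr
      simpa using hammingDist_le_card_fintype (x := σ) (y := σ')
    have h4 := hB0 σ
    have h5 := hB0 σ'
    simp only [hB] at h4 h5 ⊢
    rcases min_choice 1 (b' ^ P * Ψ σ + t * (b' ^ P * e)) with m1 | m1
    · rw [m1]; linarith
    rcases min_choice 1 (b' ^ P * Ψ σ' + t * (b' ^ P * e)) with m2 | m2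
    · rw [m2]; linarith
    rw [m1, m2]
    linarith
  have hcontr2 := abs_mulVec_sub_le_of_stochastic (pow_mem hA (t + t)) hcontr σ σ'
  set B₂ : Config n q → ℝ := (M ^ t).mulVec B with hB₂
  have hB₂0 : ∀ σ, 0 ≤ B₂ σ ∧ B₂ σ ≤ 1 := mulVec_mem_unit_of_stochastic (pow_mem hA t) hB0 hB1
  set u : ℝ := (b' ^ P * l ^ t + (η / 2) ^ P) * (q * (η⁻¹) ^ P) +
    t * ((2 * b' ^ P + (η / 2) ^ P) * e) with hu
  have hu0 : 0 ≤ u := by positivity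
  have hB₂good : ∀ σ, (∀ j, j ≠ i → η ≤ gap i j σ) → B₂ σ ≤ u := by
    intro σ hσ
    have h1 := pow_mulVec_le_of_drift hA (Ψ := Ψ) (g := B)
      (G := {σ | ∀ j, j ≠ i → η / 2 ≤ gap i j σ}) (s := b' ^ P) (u := t * (b' ^ P * e))
      (θ := (η / 2) ^ P) hl0 hl he (by positivity) (by positivity) (by positivity) hΨ hdrift
      (fun σ hσ => one_le_pow_mul_gapPot (by linarith) (by linarith) P hσ) hB0 hB1
      (fun σ => min_le_right _ _) t σ
    have h2 : Ψ σ ≤ q * (η⁻¹) ^ P := gapPot_le hη P hσ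
    have h3 : (b' ^ P * l ^ t + (η / 2) ^ P) * Ψ σ ≤
      (b' ^ P * l ^ t + (η / 2) ^ P) * (q * (η⁻¹) ^ P) := by gcongr
    rw [hu]
    linarith
  have hΨ' : ∀ σ : Config n q, 0 ≤ gapPot i δ p σ := gapPot_nonneg i hδ p
  have hB₂le : ∀ σ, B₂ σ ≤ η ^ p * gapPot i δ p σ + u := by
    intro σ
    by_cases h : ∀ j, j ≠ i → η ≤ gap i j σ
    · have := hΨ' σ
      have : 0 ≤ η ^ p * gapPot i δ p σ := by positivity
      linarith [hB₂good σ h]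
    · linarith [one_le_pow_mul_gapPot hδ hδη p h, (hB₂0 σ).2]
  have hfin : ∀ σ, (∀ j, j ≠ i → g ≤ gap i j σ) → (M ^ (t + t)).mulVec B σ ≤
      (η ^ p * l' ^ t + δ ^ p) * (q * (g⁻¹) ^ p) + t * ((η ^ p + δ ^ p) * e') + u := by
    intro σ hσ
    rw [pow_add, ← Matrix.mulVec_mulVec]
    have h1 := pow_mulVec_le_of_drift hA (Ψ := gapPot i δ p) (g := B₂)
      (G := {σ | ∀ j, j ≠ i → δ ≤ gap i j σ}) (s := η ^ p) (u := u)
      (θ := δ ^ p) hl0' hl' he' (by positivity) hu0 (by positivity) hΨ' hdrift'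
      (fun σ hσ => one_le_pow_mul_gapPot hδ (by linarith) p hσ) (fun σ => (hB₂0 σ).1)
      (fun σ => (hB₂0 σ).2) hB₂le t σ
    have h2 : gapPot i δ p σ ≤ q * (g⁻¹) ^ p := gapPot_le hg p hσ
    have h3 : (η ^ p * l' ^ t + δ ^ p) * gapPot i δ p σ ≤
      (η ^ p * l' ^ t + δ ^ p) * (q * (g⁻¹) ^ p) := by gcongr
    linarith
  rw [pow_add, ← Matrix.mulVec_mulVec]
  linarith [hfin σ hσ, hfin σ' hσ']

/-! ### Total variation between the laws of the proportions -/

-- Duality: the law at time t integrates an indicator as the initial law integrates its image under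
-- the matrix power.
open Classical in
lemma proportionsProb_lawAt (β : ℝ) (ν : Config n q → ℝ) (t : ℕ) (A : Set (Fin q → ℝ)) :
    proportionsProb (lawAt β ν t) A =
      ∑ σ, ν σ * (glauber n q β ^ t).mulVec (fun τ => if proportions τ ∈ A then 1 else 0) σ := by
  have := Matrix.dotProduct_mulVec ν (glauber n q β ^ t)
    (fun τ => if proportions τ ∈ A then 1 else 0)
  unfold dotProduct at this
  rw [this]
  simp [proportionsProb, lawAt]

/-- A bound for point masses gives a bound for any law carried by a set of good configurations. -/
lemma proportionsTV_le {β ε : ℝ} {σ₀ : Config n q} {ν : Config n q → ℝ}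
    (hν0 : ∀ σ, 0 ≤ ν σ) (hν1 : ∑ σ, ν σ = 1) {t : ℕ}
    (h : ∀ F : Config n q → ℝ, (∀ σ, 0 ≤ F σ) → (∀ σ, F σ ≤ 1) → ∀ σ, ν σ ≠ 0 →
      |(glauber n q β ^ t).mulVec F σ₀ - (glauber n q β ^ t).mulVec F σ| ≤ ε) :
    proportionsTV (lawAt β (pointMass σ₀) t) (lawAt β ν t) ≤ ε := by
  classical
  refine ciSup_le fun A => ?_
  rw [proportionsProb_lawAt, proportionsProb_lawAt]
  set F : Config n q → ℝ := fun τ => if proportions τ ∈ A then 1 else 0 with hF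
  set H := (glauber n q β ^ t).mulVec F with hH
  have h0 : ∑ σ, pointMass σ₀ σ * H σ = ∑ σ, ν σ * H σ₀ := by
    rw [← Finset.sum_mul, hν1, one_mul]
    simp [pointMass, Pi.single_apply]
  rw [h0, ← Finset.sum_sub_distrib]
  calc |∑ σ, (ν σ * H σ₀ - ν σ * H σ)| ≤ ∑ σ, |ν σ * H σ₀ - ν σ * H σ| :=
        Finset.abs_sum_le_sum_abs _ _
    _ ≤ ∑ σ, ν σ * ε := by
        refine Finset.sum_le_sum fun σ _ => ?_
        rw [← mul_sub, abs_mul, abs_of_nonneg (hν0 σ)]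
        by_cases hσ : ν σ = 0
        · simp [hσ]
        · exact mul_le_mul_of_nonneg_left (h F (fun τ => by simp only [hF]; split_ifs <;> simp)
            (fun τ => by simp only [hF]; split_ifs <;> simp) σ hσ) (hν0 σ)
    _ = ε := by rw [← Finset.sum_mul, hν1, one_mul]

/-! ### The Potts measure conditioned on an ordered phase. -/

lemma weight_pos (β : ℝ) (σ : Config n q) : 0 < weight β σ := Real.exp_pos _

lemma gibbs_pos (β : ℝ) (σ : Config n q) : 0 < gibbs n q β σ :=
  div_pos (weight_pos β σ) (Finset.sum_pos (fun _ _ => weight_pos β _) ⟨σ, Finset.mem_univ σ⟩)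

lemma gibbsOrdered_nonneg (β : ℝ) (i : Fin q) (r : ℝ) (σ : Config n q) :
    0 ≤ gibbsOrdered n q β i r σ := by
  unfold gibbsOrdered
  refine div_nonneg ?_ (Finset.sum_nonneg fun τ _ => ?_) <;>
  · split_ifs
    · exact (gibbs_pos β _).le
    · exact le_rfl

lemma sum_gibbsOrdered {β : ℝ} {i : Fin q} {r : ℝ} (h : (orderedPhase n q β i r).Nonempty) :
    ∑ σ, gibbsOrdered n q β i r σ = 1 := by
  classical
  unfold gibbsOrdered
  rw [← Finset.sum_div]
  refine div_self (ne_of_gt ?_)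
  obtain ⟨σ, hσ⟩ := h
  refine Finset.sum_pos' (fun τ _ => ?_) ⟨σ, Finset.mem_univ σ, ?_⟩
  · split_ifs
    · exact (gibbs_pos β _).le
    · exact le_rfl
  · rw [if_pos hσ]
    exact gibbs_pos β σ

lemma mem_orderedPhase_of_gibbsOrdered_ne_zero {β : ℝ} {i : Fin q} {r : ℝ} {σ : Config n q}
    (h : gibbsOrdered n q β i r σ ≠ 0) : σ ∈ orderedPhase n q β i r := by
  by_contra hσ
  exact h (by simp [gibbsOrdered, hσ])

lemma gap_ge_of_mem_orderedPhase {β : ℝ} {i : Fin q} {r : ℝ} {σ : Config n q}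
    (h : σ ∈ orderedPhase n q β i r) {j : Fin q} (hj : j ≠ i) :
    mr q β - (1 - mr q β) / ((q : ℝ) - 1) - 2 * r ≤ gap i j σ := by
  have h1 : ∀ k, |proportions σ k - orderedPoint q β i k| ≤ r := fun k =>
    (Finset.single_le_sum (f := fun k => |proportions σ k - orderedPoint q β i k|)
      (fun _ _ => abs_nonneg _) (Finset.mem_univ k)).trans h
  have hi := (abs_le.1 (h1 i)).1
  have hj' := (abs_le.1 (h1 j)).2
  simp only [orderedPoint, if_true, if_neg hj] at hi hj'
  unfold gap
  linarith

end Dynamics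

/-! ### Asymptotics -/

/-- From 1 - y ≤ exp(-y): a decay rate x/n over Cn log n steps yields the power n^(-xC). -/
lemma one_sub_div_pow_le {x C : ℝ} {n m t : ℕ} (hn : 0 < n) (hx0 : 0 ≤ x) (hx : x / n ≤ 1)
    (ht : C * (n * Real.log n) ≤ t) (hm : (m : ℝ) ≤ x * C) :
    (1 - x / n) ^ t ≤ ((n : ℝ)⁻¹) ^ m := by
  have hn' : (0 : ℝ) < n := by exact_mod_cast hn
  have hlog : 0 ≤ Real.log n := Real.log_natCast_nonneg n
  calc (1 - x / n) ^ t ≤ (Real.exp (-(x / n))) ^ t := by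
        have := Real.one_sub_le_exp_neg (x / n)
        have : 0 ≤ 1 - x / n := by linarith
        gcongr
    _ = Real.exp (t * -(x / n)) := by rw [Real.exp_nat_mul]
    _ ≤ Real.exp (m * -Real.log n) := by
        apply Real.exp_le_exp.2
        have h1 : x / n * (C * (n * Real.log n)) ≤ x / n * t := by gcongr
        have h2 : x / n * (C * (n * Real.log n)) = x * C * Real.log n := by field_simp
        have h3 : m * Real.log n ≤ x * C * Real.log n := by gcongr
        linarith
    _ = ((n : ℝ)⁻¹) ^ m := by rw [Real.exp_nat_mul, Real.exp_neg, Real.exp_log hn']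

lemma tendsto_sqrt_sqrt_natCast : Tendsto (fun n : ℕ => √√(n : ℝ)) atTop atTop :=
  Real.tendsto_sqrt_atTop.comp (Real.tendsto_sqrt_atTop.comp tendsto_natCast_atTop_atTop)

lemma tendsto_log_mul_inv_sqrt_sqrt (C : ℝ) :
    Tendsto (fun n : ℕ => (C * Real.log n + 1) * (√√(n : ℝ))⁻¹) atTop (𝓝 0) := by
  have h1 : Tendsto (fun x : ℝ => Real.log x / x ^ (1 / 4 : ℝ)) atTop (𝓝 0) :=
    (isLittleO_log_rpow_atTop (by norm_num)).tendsto_div_nhds_zero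
  have h2 := h1.comp tendsto_natCast_atTop_atTop (α := ℕ)
  have h3 : Tendsto (fun n : ℕ => (√√(n : ℝ))⁻¹) atTop (𝓝 0) :=
    tendsto_sqrt_sqrt_natCast.inv_tendsto_atTop
  have h4 := (h2.const_mul C).add h3
  simp only [mul_zero, add_zero] at h4
  refine h4.congr fun n => ?_
  have : √√(n : ℝ) = (n : ℝ) ^ (1 / 4 : ℝ) := by
    rw [Real.sqrt_eq_rpow, Real.sqrt_eq_rpow, ← Real.rpow_mul (Nat.cast_nonneg n)]
    norm_num
  simp only [Function.comp_apply, this]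
  ring

/-- The exponent is of order √n, so the decay beats n², a crude bound on the number of steps up to a
constant. -/
lemma tendsto_sq_mul_pow_floor_sqrt {K x : ℝ} (hK : 1 ≤ K) (hx0 : 0 ≤ x) (hx1 : x < 1) :
    Tendsto (fun n : ℕ => (n : ℝ) ^ 2 * x ^ ⌊√(n : ℝ) / K⌋₊) atTop (𝓝 0) := by
  have hP : Tendsto (fun n : ℕ => ⌊√(n : ℝ) / K⌋₊) atTop atTop :=
    tendsto_nat_floor_atTop.comp ((Real.tendsto_sqrt_atTop.comp
      tendsto_natCast_atTop_atTop).atTop_div_const (by linarith))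
  have h1 := ((tendsto_pow_const_mul_const_pow_of_abs_lt_one 4
    (show |x| < 1 by rwa [abs_of_nonneg hx0])).comp hP).const_mul ((2 * K) ^ 4)
  rw [mul_zero] at h1
  refine squeeze_zero' (Eventually.of_forall fun n => by positivity) ?_ h1
  filter_upwards [hP.eventually_ge_atTop 1] with n hn
  simp only [Function.comp_apply]
  set P := ⌊√(n : ℝ) / K⌋₊ with hPdef
  have hP1 : (1 : ℝ) ≤ P := by exact_mod_cast hn
  have h2 : √(n : ℝ) ≤ 2 * K * P := by
    have := (Nat.lt_floor_add_one (√(n : ℝ) / K)).le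
    rw [div_le_iff₀ (by linarith), ← hPdef] at this
    nlinarith
  have h3 : (n : ℝ) ^ 2 ≤ (2 * K) ^ 4 * (P : ℝ) ^ 4 := by
    calc (n : ℝ) ^ 2 = √(n : ℝ) ^ 4 := by
          rw [show (4 : ℕ) = 2 * 2 from rfl, pow_mul, Real.sq_sqrt (Nat.cast_nonneg n)]
      _ ≤ (2 * K * P) ^ 4 := by gcongr
      _ = _ := by ring
  calc (n : ℝ) ^ 2 * x ^ P ≤ (2 * K) ^ 4 * (P : ℝ) ^ 4 * x ^ P := by gcongr
    _ = _ := by ring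

/-- The duration of a phase. -/
noncomputable def phaseTime (C : ℝ) (n : ℕ) : ℕ := ⌈C * (n * Real.log n)⌉₊

lemma le_phaseTime (C : ℝ) (n : ℕ) : C * (n * Real.log n) ≤ phaseTime C n := Nat.le_ceil _

lemma phaseTime_le {C : ℝ} (hC : 0 ≤ C) (n : ℕ) :
    (phaseTime C n : ℝ) ≤ C * (n * Real.log n) + 1 := by
  have := Real.log_natCast_nonneg n
  exact (Nat.ceil_lt_add_one (by positivity)).le

lemma phaseTime_isBigO {C : ℝ} (hC : 0 ≤ C) :
    (fun n : ℕ => ((phaseTime C n + phaseTime C n + phaseTime C n : ℕ) : ℝ)) =O[atTop]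
      (fun n : ℕ => (n : ℝ) * Real.log n) := by
  refine IsBigO.of_bound (3 * (C + 1)) ?_
  filter_upwards [eventually_ge_atTop 3] with n hn
  have h1 : (3 : ℝ) ≤ n := by exact_mod_cast hn
  have h2 : 1 ≤ Real.log n := by
    rw [Real.le_log_iff_exp_le (by linarith)]
    linarith [Real.exp_one_lt_d9]
  have h3 : 1 ≤ (n : ℝ) * Real.log n := by nlinarith
  rw [Real.norm_of_nonneg (by positivity), Real.norm_of_nonneg (by linarith)]
  push_cast
  linarith [phaseTime_le hC n]

/-- All the error terms of the three phases vanish, except the one of order `γ ^ (-p)`. -/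
lemma tendsto_error_terms {C K x s₀ γ Q A : ℝ} (hC : 0 ≤ C) (hK : 1 ≤ K) (hx0 : 0 ≤ x)
    (hx1 : x < 1) (hQ : 0 ≤ Q) {p : ℕ} (hp : p ≠ 0) :
    Tendsto (fun n : ℕ => (n : ℝ)⁻¹ + 2 * (((√√(n : ℝ))⁻¹ * γ⁻¹) ^ p * Q + (s₀ / γ) ^ p * Q +
      (C * Real.log n + 1) * (√√(n : ℝ))⁻¹ * A +
      (2 * Q + 6 * Q * phaseTime C n) * x ^ ⌊√(n : ℝ) / K⌋₊)) atTop
      (𝓝 (2 * ((s₀ / γ) ^ p * Q))) := by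
  have h1 : Tendsto (fun n : ℕ => (n : ℝ)⁻¹) atTop (𝓝 0) := tendsto_inv_atTop_nhds_zero_nat
  have h2 : Tendsto (fun n : ℕ => ((√√(n : ℝ))⁻¹ * γ⁻¹) ^ p * Q) atTop (𝓝 0) := by
    have := (((tendsto_sqrt_sqrt_natCast.inv_tendsto_atTop).mul_const γ⁻¹).pow p).mul_const Q
    simpa [hp] using this
  have h3 := (tendsto_log_mul_inv_sqrt_sqrt C).mul_const A
  have h4 : Tendsto (fun n : ℕ => (2 * Q + 6 * Q * phaseTime C n) * x ^ ⌊√(n : ℝ) / K⌋₊)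
      atTop (𝓝 0) := by
    have h5 := (tendsto_sq_mul_pow_floor_sqrt hK hx0 hx1).const_mul (2 * Q + 6 * Q * (C + 1))
    rw [mul_zero] at h5
    refine squeeze_zero' (Eventually.of_forall fun n => by positivity) ?_ h5
    filter_upwards [eventually_ge_atTop 1] with n hn
    have hn1 : (1 : ℝ) ≤ n := by exact_mod_cast hn
    have hn2 : 1 ≤ (n : ℝ) ^ 2 := one_le_pow₀ hn1
    have h6 : (phaseTime C n : ℝ) ≤ (C + 1) * (n : ℝ) ^ 2 := by
      have h7 : Real.log n ≤ n := (Real.log_le_sub_one_of_pos (by linarith)).trans (by linarith)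
      have h8 : C * (n * Real.log n) ≤ C * (n * n) := by gcongr
      nlinarith [phaseTime_le hC n]
    rw [← mul_assoc]
    gcongr
    have h9 : 6 * Q * phaseTime C n ≤ 6 * Q * ((C + 1) * (n : ℝ) ^ 2) := by gcongr
    have h10 : 2 * Q * 1 ≤ 2 * Q * (n : ℝ) ^ 2 := by gcongr
    linarith
  have h5 := h1.add ((((h2.add_const ((s₀ / γ) ^ p * Q)).add h3).add h4).const_mul 2)
  simpa using h5

/-- The error terms of the three phases for a fixed number of vertices. -/
lemma phase_error_le {C c κ a b' x s₀ γ S r : ℝ} {n p P q : ℕ} (hn : 0 < n) (hC0 : 0 ≤ C)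
    (hc0 : 0 < c) (hCc : 1 ≤ c / 8 * C) (hκ0 : 0 ≤ κ) (hκ1 : κ < 1) (hCκ : 2 ≤ (1 - κ) * C)
    (ha0 : 0 < a) (hb'0 : 0 < b') (hb'1 : b' ≤ 1) (hx2 : 1 / 2 ≤ x) (hxb : b' / a ≤ x)
    (hs₀0 : 0 ≤ s₀) (hγ : 0 < γ) (hS2 : S ^ 2 = n) (hrS : r ^ 2 = S) (hr2 : 2 ≤ r)
    (hηb : r⁻¹ / 2 ≤ b') (hp1 : 1 ≤ p) (hP1 : 1 ≤ P) (hPn : (P : ℝ) / n ≤ 1)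
    (hlP : 0 ≤ 1 - c / 8 * ((P : ℝ) / n)) (hlp : 0 ≤ 1 - c / 8 * ((p : ℝ) / n)) :
    (1 - (1 - κ) / n) ^ phaseTime C n * n +
      2 * (((r⁻¹) ^ p * (1 - c / 8 * ((p : ℝ) / n)) ^ phaseTime C n + (s₀ / S) ^ p) *
          (q * ((γ / S)⁻¹) ^ p) +
        phaseTime C n * (((r⁻¹) ^ p + (s₀ / S) ^ p) * (2 * q * ((p : ℝ) / n) * (a⁻¹) ^ p)) +
        ((b' ^ P * (1 - c / 8 * ((P : ℝ) / n)) ^ phaseTime C n + (r⁻¹ / 2) ^ P) *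
          (q * ((r⁻¹)⁻¹) ^ P) +
          phaseTime C n * ((2 * b' ^ P + (r⁻¹ / 2) ^ P) * (2 * q * ((P : ℝ) / n) * (a⁻¹) ^ P)))) ≤
    (n : ℝ)⁻¹ + 2 * ((r⁻¹ * γ⁻¹) ^ p * q + (s₀ / γ) ^ p * q +
      (C * Real.log n + 1) * r⁻¹ * ((1 + s₀ ^ p) * (2 * q * p * (a⁻¹) ^ p)) +
      (2 * q + 6 * q * phaseTime C n) * x ^ P) := by
  have hn1 : (1 : ℝ) ≤ n := by exact_mod_cast hn
  have hr0 : 0 < r := by linarith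
  have hrSle : r ≤ S := by rw [← hrS]; nlinarith
  have hS1 : 1 ≤ S := by linarith
  have hS0 : 0 < S := by linarith
  have hx0 : 0 ≤ x := by linarith
  have hr1 : r⁻¹ ≤ 1 := inv_le_one_of_one_le₀ (by linarith)
  have hlog := Real.log_natCast_nonneg n
  have hle := le_phaseTime C n
  have htle := phaseTime_le hC0 n
  generalize phaseTime C n = t at *
  have e1 : (1 - (1 - κ) / n) ^ t ≤ ((n : ℝ)⁻¹) ^ 2 :=
    one_sub_div_pow_le hn (by linarith) ((div_le_one (by linarith)).2 (by linarith)) hle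
      (by exact_mod_cast hCκ)
  have e2 : (1 - c / 8 * ((P : ℝ) / n)) ^ t ≤ ((n : ℝ)⁻¹) ^ P := by
    rw [mul_div_assoc']
    refine one_sub_div_pow_le hn (by positivity) ?_ hle ?_
    · rw [mul_div_assoc]; linarith [hlP]
    · linarith [mul_le_mul_of_nonneg_left hCc (Nat.cast_nonneg (α := ℝ) P)]
  have e3 : (1 - c / 8 * ((p : ℝ) / n)) ^ t ≤ ((n : ℝ)⁻¹) ^ p := by
    rw [mul_div_assoc']
    refine one_sub_div_pow_le hn (by positivity) ?_ hle ?_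
    · rw [mul_div_assoc]; linarith [hlp]
    · linarith [mul_le_mul_of_nonneg_left hCc (Nat.cast_nonneg (α := ℝ) p)]
  have f1 : (1 - (1 - κ) / n) ^ t * n ≤ (n : ℝ)⁻¹ := by
    calc (1 - (1 - κ) / n) ^ t * n ≤ ((n : ℝ)⁻¹) ^ 2 * n := by gcongr
      _ = (n : ℝ)⁻¹ := by field_simp
  have f2 : (r⁻¹ ^ p * (1 - c / 8 * ((p : ℝ) / n)) ^ t + (s₀ / S) ^ p) * (q * ((γ / S)⁻¹) ^ p) ≤
      (r⁻¹ * γ⁻¹) ^ p * q + (s₀ / γ) ^ p * q := by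
    have g1 : (s₀ / S) ^ p * ((γ / S)⁻¹) ^ p = (s₀ / γ) ^ p := by
      rw [← mul_pow]; congr 1; field_simp
    have g2 : r⁻¹ ^ p * ((n : ℝ)⁻¹) ^ p * ((γ / S)⁻¹) ^ p ≤ (r⁻¹ * γ⁻¹) ^ p := by
      rw [← mul_pow, ← mul_pow]
      refine pow_le_pow_left₀ (by positivity) ?_ p
      rw [← hS2]
      calc r⁻¹ * (S ^ 2)⁻¹ * (γ / S)⁻¹ = r⁻¹ * γ⁻¹ * S⁻¹ := by field_simp
        _ ≤ r⁻¹ * γ⁻¹ * 1 := by gcongr; exact inv_le_one_of_one_le₀ hS1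
        _ = r⁻¹ * γ⁻¹ := mul_one _
    calc (r⁻¹ ^ p * (1 - c / 8 * ((p : ℝ) / n)) ^ t + (s₀ / S) ^ p) * (q * ((γ / S)⁻¹) ^ p)
        ≤ (r⁻¹ ^ p * ((n : ℝ)⁻¹) ^ p + (s₀ / S) ^ p) * (q * ((γ / S)⁻¹) ^ p) := by gcongr
      _ = r⁻¹ ^ p * ((n : ℝ)⁻¹) ^ p * ((γ / S)⁻¹) ^ p * q + (s₀ / S) ^ p * ((γ / S)⁻¹) ^ p * q := by ring
      _ ≤ _ := by rw [g1]; gcongr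
  have hηp : r⁻¹ ^ p ≤ r⁻¹ := pow_le_of_le_one (by positivity) hr1 (by omega)
  have hδp : (s₀ / S) ^ p ≤ s₀ ^ p * r⁻¹ := by
    rw [div_eq_mul_inv, mul_pow]
    gcongr
    refine (pow_le_of_le_one (by positivity) (inv_le_one_of_one_le₀ hS1) (by omega)).trans ?_
    gcongr
  have htn : (t : ℝ) / n ≤ C * Real.log n + 1 := by
    rw [div_le_iff₀ (by linarith)]
    linarith
  have f3 : t * ((r⁻¹ ^ p + (s₀ / S) ^ p) * (2 * q * ((p : ℝ) / n) * (a⁻¹) ^ p)) ≤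
      (C * Real.log n + 1) * r⁻¹ * ((1 + s₀ ^ p) * (2 * q * p * (a⁻¹) ^ p)) := by
    calc t * ((r⁻¹ ^ p + (s₀ / S) ^ p) * (2 * q * ((p : ℝ) / n) * (a⁻¹) ^ p))
        ≤ t * ((r⁻¹ + s₀ ^ p * r⁻¹) * (2 * q * ((p : ℝ) / n) * (a⁻¹) ^ p)) := by gcongr
      _ = (t : ℝ) / n * (r⁻¹ * ((1 + s₀ ^ p) * (2 * q * p * (a⁻¹) ^ p))) := by ring
      _ ≤ (C * Real.log n + 1) * (r⁻¹ * ((1 + s₀ ^ p) * (2 * q * p * (a⁻¹) ^ p))) := by gcongr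
      _ = _ := by ring
  have hhalf : (1 / 2 : ℝ) ^ P ≤ x ^ P := by gcongr
  have f4 : (b' ^ P * (1 - c / 8 * ((P : ℝ) / n)) ^ t + (r⁻¹ / 2) ^ P) * (q * (r⁻¹⁻¹) ^ P) ≤
      2 * q * x ^ P := by
    have g1 : (r⁻¹ / 2) ^ P * (r⁻¹⁻¹) ^ P = (1 / 2 : ℝ) ^ P := by
      rw [← mul_pow]; congr 1; field_simp
    have g2 : b' ^ P * ((n : ℝ)⁻¹) ^ P * (r⁻¹⁻¹) ^ P ≤ (1 / 2 : ℝ) ^ P := by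
      rw [← mul_pow, ← mul_pow]
      refine pow_le_pow_left₀ (by positivity) ?_ P
      rw [inv_inv, ← hS2, ← hrS]
      calc b' * ((r ^ 2) ^ 2)⁻¹ * r ≤ 1 * ((r ^ 2) ^ 2)⁻¹ * r := by gcongr
        _ = 1 / r ^ 3 := by field_simp
        _ ≤ 1 / 2 := by
            have : (2 : ℝ) ^ 3 ≤ r ^ 3 := by gcongr
            gcongr
            linarith
    calc (b' ^ P * (1 - c / 8 * ((P : ℝ) / n)) ^ t + (r⁻¹ / 2) ^ P) * (q * (r⁻¹⁻¹) ^ P)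
        ≤ (b' ^ P * ((n : ℝ)⁻¹) ^ P + (r⁻¹ / 2) ^ P) * (q * (r⁻¹⁻¹) ^ P) := by gcongr
      _ = b' ^ P * ((n : ℝ)⁻¹) ^ P * (r⁻¹⁻¹) ^ P * q + (r⁻¹ / 2) ^ P * (r⁻¹⁻¹) ^ P * q := by ring
      _ ≤ x ^ P * q + x ^ P * q := by rw [g1]; gcongr; exact g2.trans hhalf
      _ = 2 * q * x ^ P := by ring
  have f5 : t * ((2 * b' ^ P + (r⁻¹ / 2) ^ P) * (2 * q * ((P : ℝ) / n) * (a⁻¹) ^ P)) ≤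
      6 * q * t * x ^ P := by
    have g1 : (r⁻¹ / 2) ^ P ≤ b' ^ P := by gcongr
    have g2 : b' ^ P * (a⁻¹) ^ P ≤ x ^ P := by
      rw [← mul_pow, ← div_eq_mul_inv]; gcongr
    calc t * ((2 * b' ^ P + (r⁻¹ / 2) ^ P) * (2 * q * ((P : ℝ) / n) * (a⁻¹) ^ P))
        ≤ t * ((2 * b' ^ P + b' ^ P) * (2 * q * 1 * (a⁻¹) ^ P)) := by gcongr
      _ = 6 * q * t * (b' ^ P * (a⁻¹) ^ P) := by ring
      _ ≤ _ := by gcongr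
  linarith


set_option maxHeartbeats 400000 in
/-- Two biased starting configurations give nearly the same law after time of order `n log n`. -/
theorem exists_time_abs_pow_mulVec_sub_le {q : ℕ} (hq : 2 < q) {β : ℝ} (hβ : (q : ℝ) < β) :
    ∃ (T : ℕ → ℕ) (err : ℝ → ℝ),
      (fun n : ℕ => (T n : ℝ)) =O[atTop] (fun n : ℕ => (n : ℝ) * Real.log n) ∧
      Tendsto err atTop (𝓝 0) ∧
      ∀ γ : ℝ, 0 < γ → ∀ᶠ n : ℕ in atTop, ∀ (i : Fin q) (σ σ' : Config n q),
        (∀ j, j ≠ i → γ / √(n : ℝ) ≤ gap i j σ) → (∀ j, j ≠ i → γ / √(n : ℝ) ≤ gap i j σ') →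
        ∀ F : Config n q → ℝ, (∀ σ, 0 ≤ F σ) → (∀ σ, F σ ≤ 1) →
          |(glauber n q β ^ T n).mulVec F σ - (glauber n q β ^ T n).mulVec F σ'| ≤ err γ := by
  have hq' : (2 : ℝ) < q := by exact_mod_cast hq
  have hβ0 : 0 < β := by linarith
  obtain ⟨b, a, c, hb, hba, ha1, hc0, hc1, hexpand, hκ1, hE⟩ := exists_gap_constants hq hβ
  have ha0 : 0 < a := hb.trans hba
  set κ := gapSlope q β (Real.exp (-β * b)) with hκ
  have hκ0 : 0 ≤ κ := by
    have := gapMap_den_pos hq (Real.exp_pos (-β * b))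
    rw [hκ]; unfold gapSlope
    positivity
  set ρ : ℝ := (1 + c / 4) / (1 + c / 2) with hρ
  have hρ0 : 0 < ρ := by positivity
  have hρ1 : ρ < 1 := by rw [hρ, div_lt_one (by positivity)]; linarith
  obtain ⟨p, hp⟩ : ∃ p : ℕ, 1 ≤ p ∧ 2 * q * ρ ^ p ≤ c / 4 := by
    have h1 := (tendsto_pow_atTop_nhds_zero_of_lt_one hρ0.le hρ1).const_mul (2 * (q : ℝ))
    rw [mul_zero] at h1
    have h2 := h1.eventually_le_const (show 0 < c / 4 by linarith)
    exact ((eventually_ge_atTop 1).and h2).exists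
  obtain ⟨hp1, hpρ⟩ := hp
  have hPρ : ∀ P, p ≤ P → 2 * q * ρ ^ P ≤ c / 4 := fun P hP =>
    le_trans (mul_le_mul_of_nonneg_left (pow_le_pow_of_le_one hρ0.le hρ1.le hP) (by positivity)) hpρ
  have hp' : (1 : ℝ) ≤ p := by exact_mod_cast hp1
  set K : ℝ := 128 / c with hK
  have hK1 : 128 ≤ K := by rw [hK, le_div_iff₀ hc0]; nlinarith
  -- With δ = s₀/√n, the requirement Kp ≤ nδ² of the first phase holds with equality.
  set s₀ : ℝ := √(K * p) with hs₀
  have hs₀2 : s₀ ^ 2 = K * p := Real.sq_sqrt (by positivity)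
  have hs₀0 : 0 < s₀ := Real.sqrt_pos.2 (by positivity)
  -- The first entry makes each potential decay by n^(-exponent) in a growth phase; the second makes
  -- the contraction factor at most n^(-2), against a distance at most n.
  set C : ℝ := max (8 / c) (2 / (1 - κ)) with hC
  have hC0 : 0 ≤ C := le_max_of_le_left (by positivity)
  have hCc : 1 ≤ c / 8 * C := by
    have : c / 8 * (8 / c) ≤ c / 8 * C := by gcongr; exact le_max_left _ _
    rwa [show c / 8 * (8 / c) = 1 by field_simp] at this
  have hCκ : 2 ≤ (1 - κ) * C := by
    have h1 : 0 < 1 - κ := by linarith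
    have : (1 - κ) * (2 / (1 - κ)) ≤ (1 - κ) * C := by gcongr; exact le_max_right _ _
    rwa [mul_div_cancel₀ _ h1.ne'] at this
  -- Above b leaves room for the 1/n correction; below a makes (b'/a)^P exponentially small.
  set b' : ℝ := (a + b) / 2 with hb'
  have hb'0 : 0 < b' := by linarith
  have hb'1 : b' ≤ 1 := by linarith
  set x : ℝ := max (1 / 2) (b' / a) with hx
  have hx0 : 0 ≤ x := le_max_of_le_left (by norm_num)
  have hx1 : x < 1 := max_lt (by norm_num) (by rw [div_lt_one ha0]; linarith)
  have hx2 : 1 / 2 ≤ x := le_max_left _ _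
  have hxb : b' / a ≤ x := le_max_right _ _
  clear_value κ K s₀ C b' x
  -- The limiting error is 2q(s₀/γ)^p; replacing 2q by 2q + 1 leaves slack for finite n.
  refine ⟨fun n => phaseTime C n + phaseTime C n + phaseTime C n,
    fun γ => (2 * q + 1) * (s₀ / γ) ^ p, phaseTime_isBigO hC0, ?_, ?_⟩
  · have h1 : Tendsto (fun γ : ℝ => s₀ / γ) atTop (𝓝 0) := tendsto_const_nhds.div_atTop tendsto_id
    have h2 := (h1.pow p).const_mul (2 * (q : ℝ) + 1)
    simpa [show p ≠ 0 by omega] using h2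
  intro γ hγ
  have hlim := tendsto_error_terms (C := C) (K := 4 * K) (x := x) (s₀ := s₀) (γ := γ) (Q := q)
    (A := (1 + s₀ ^ p) * (2 * q * p * (a⁻¹) ^ p)) (p := p) hC0 (by linarith) hx0 hx1 (by positivity) (by omega)
  have hpos : 0 < (s₀ / γ) ^ p := by positivity
  have hPlim : Tendsto (fun n : ℕ => ⌊√(n : ℝ) / (4 * K)⌋₊) atTop atTop :=
    tendsto_nat_floor_atTop.comp ((Real.tendsto_sqrt_atTop.comp
      tendsto_natCast_atTop_atTop).atTop_div_const (by linarith))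
  filter_upwards [hlim.eventually_le_const
      (show 2 * ((s₀ / γ) ^ p * q) < (2 * q + 1) * (s₀ / γ) ^ p by linarith),
    hPlim.eventually_ge_atTop p, eventually_ge_atTop 1,
    tendsto_sqrt_sqrt_natCast.eventually_ge_atTop (max 2 (max s₀ b'⁻¹)),
    tendsto_inv_atTop_nhds_zero_nat.eventually_le_const (show 0 < b' - b by linarith)]
    with n hlimn hPp hn hr hnb i σ σ' hσ hσ' F hF0 hF1
  refine le_trans ?_ hlimn
  have hn1 : (1 : ℝ) ≤ n := by exact_mod_cast hn
  set P := ⌊√(n : ℝ) / (4 * K)⌋₊ with hP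
  set t := phaseTime C n with ht
  set S := √(n : ℝ) with hS
  set r := √S with hrdef
  have hr2 : 2 ≤ r := (le_max_left _ _).trans hr
  have hrs : s₀ ≤ r := (le_max_left _ _).trans ((le_max_right _ _).trans hr)
  have hrb : b'⁻¹ ≤ r := (le_max_right _ _).trans ((le_max_right _ _).trans hr)
  have hS2 : S ^ 2 = n := Real.sq_sqrt (by positivity)
  have hS0 : 0 < S := Real.sqrt_pos.2 (by linarith)
  have hrS : r ^ 2 = S := Real.sq_sqrt hS0.le
  have hr0 : 0 < r := by linarith
  have hrSle : r ≤ S := by rw [← hrS]; nlinarith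
  have hS1 : 1 ≤ S := by linarith
  have hP1 : (1 : ℝ) ≤ P := by exact_mod_cast hp1.trans hPp
  have hPS : (P : ℝ) * (4 * K) ≤ S := by
    have := Nat.floor_le (show 0 ≤ S / (4 * K) by positivity)
    rwa [← hP, le_div_iff₀ (by linarith)] at this
  have hPn : (P : ℝ) / n ≤ 1 := by
    rw [div_le_one (by linarith), ← hS2]
    have h1 : (P : ℝ) * 1 ≤ P * (4 * K) := by gcongr; linarith
    have h2 : S * 1 ≤ S * S := by gcongr
    linarith
  have hpn : (p : ℝ) / n ≤ 1 := by
    refine le_trans ?_ hPn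
    gcongr
  -- Here η = n^(-1/4). It tends to 0, so the additive error of the first phase, of order η^p log n,
  -- vanishes; it is large enough that n(η/2)² = √n/4 allows an exponent P of order √n.
  set η := r⁻¹ with hη
  have hη0 : 0 < η := by positivity
  have hη1 : η ≤ 1 := inv_le_one_of_one_le₀ (by linarith)
  set δ := s₀ / S with hδ
  have hδ0 : 0 < δ := by positivity
  have hδη : δ ≤ η := by
    rw [hδ, hη, div_le_iff₀ hS0, ← hrS, pow_two, inv_mul_cancel_left₀ hr0.ne']
    exact hrs
  have hηb : η ≤ b' := inv_le_of_inv_le₀ hb'0 hrb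
  have hdrift := fun (τ : Config n q) hτ => glauber_mulVec_gapPot_le (β := β) (δ := η / 2) (P := P)
    (i := i) (σ := τ) hβ0 hq hn ha0 hc0 hc1 hexpand (hp1.trans hPp) (hPρ P hPp) (by positivity)
    (by linarith) (by
      rw [← hK, hη, ← hS2, ← hrS]
      rw [← hrS] at hPS
      field_simp
      linarith) hτ
  have hdrift' := fun (τ : Config n q) hτ => glauber_mulVec_gapPot_le (β := β) (δ := δ) (P := p)
    (i := i) (σ := τ) hβ0 hq hn ha0 hc0 hc1 hexpand hp1 (hPρ p le_rfl) hδ0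
    (hδη.trans hη1) (by
      rw [← hK, hδ, div_pow, hS2, hs₀2]
      field_simp
      exact le_rfl) hτ
  have hcx : ∀ y : ℝ, 0 ≤ y → y ≤ 1 → 0 ≤ 1 - c / 8 * y ∧ 1 - c / 8 * y ≤ 1 := by
    intro y h0 h1
    have h2 : c / 8 * y ≤ 1 * 1 := by gcongr; linarith
    have h3 : 0 ≤ c / 8 * y := by positivity
    constructor <;> linarith
  have hlP := hcx (P / n) (by positivity) hPn
  have hlp := hcx (p / n) (by positivity) hpn
  have hmain := abs_pow_mulVec_sub_le_of_biased hβ0 hb.le hq hn hE hκ.ge hκ0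
    (b' := b') (by rw [one_div]; linarith) hη0 (by linarith) hlP.1 hlP.2 (by positivity)
    hdrift hδ0 (by linarith) hlp.1 hlp.2 (by positivity) hdrift' hF0 hF1 t
    (show 0 < γ / S by positivity) hσ hσ'
  refine hmain.trans ?_
  exact phase_error_le hn hC0 hc0 hCc hκ0 hκ1 hCκ ha0 hb'0 hb'1 hx2 hxb hs₀0.le hγ hS2 hrS hr2 (by linarith) hp1 (hp1.trans hPp) hPn hlP.1 hlp.1

end Potts

/-- In the ordered phase every gap is at least a positive constant minus 2r_n, eventually above
γ/√n. Both initial laws are therefore carried by biased configurations and the pointwise comparison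
applies. -/
theorem mainTheorem7 (q : ℕ) (hq : 2 < q) (β : ℝ) (hβ : Potts.betaS q < β) :
    ∃ (T : ℕ → ℕ) (err : ℝ → ℝ),
      (fun n : ℕ => (T n : ℝ)) =O[atTop] (fun n : ℕ => (n : ℝ) * Real.log n) ∧
      Tendsto err atTop (𝓝 0) ∧
      ∀ (i : Fin q) (r : ℕ → ℝ), Tendsto r atTop (𝓝 0) →
        (∀ᶠ n : ℕ in atTop, (Potts.orderedPhase n q β i (r n)).Nonempty) →
        ∀ γ : ℝ, 0 < γ → ∀ᶠ n : ℕ in atTop, ∀ σ₀ : Potts.Config n q,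
          (∀ j : Fin q, j ≠ i →
            Potts.proportions σ₀ i > Potts.proportions σ₀ j + γ * (n : ℝ) ^ (-(1 / 2) : ℝ)) →
          Potts.proportionsTV
              (Potts.lawAt β (Potts.pointMass σ₀) (T n))
              (Potts.lawAt β (Potts.gibbsOrdered n q β i (r n)) (T n)) ≤ err γ := by
  have hβ' : (q : ℝ) < β := hβ
  have hq' : (2 : ℝ) < q := by exact_mod_cast hq
  obtain ⟨T, err, hT, herr, h⟩ := Potts.exists_time_abs_pow_mulVec_sub_le hq hβ'
  refine ⟨T, err, hT, herr, fun i r hr hne γ hγ => ?_⟩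
  set D : ℝ := Potts.mr q β - (1 - Potts.mr q β) / ((q : ℝ) - 1) with hD
  have hD0 : 0 < D := by
    have := Potts.one_div_lt_mr hq hβ'
    rw [div_lt_iff₀ (by linarith)] at this
    rw [hD, sub_pos, div_lt_iff₀ (by linarith)]
    linarith
  have hlim : Tendsto (fun n : ℕ => γ / √(n : ℝ) + 2 * r n) atTop (𝓝 0) := by
    have h1 : Tendsto (fun n : ℕ => γ / √(n : ℝ)) atTop (𝓝 0) :=
      tendsto_const_nhds.div_atTop
        (Real.tendsto_sqrt_atTop.comp tendsto_natCast_atTop_atTop)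
    simpa using h1.add (hr.const_mul 2)
  filter_upwards [h γ hγ, hne, hlim.eventually_le_const hD0] with n hn hnen hsmall σ₀ hσ₀
  refine Potts.proportionsTV_le (Potts.gibbsOrdered_nonneg β i (r n))
    (Potts.sum_gibbsOrdered hnen) fun F hF0 hF1 σ hσ => ?_
  refine hn i σ₀ σ (fun j hj => ?_) (fun j hj => ?_) F hF0 hF1
  · have h1 := hσ₀ j hj
    rw [Real.rpow_neg (Nat.cast_nonneg n), ← Real.sqrt_eq_rpow, ← div_eq_mul_inv] at h1
    unfold Potts.gap
    linarith
  · have := Potts.gap_ge_of_mem_orderedPhase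
      (Potts.mem_orderedPhase_of_gibbsOrdered_ne_zero hσ) hj
    linarith
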